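/- **Theorem (Robust offset-free stability).** All vector spaces carry the Euclidean norm $|\cdot|$, and $|x|_Q^2:=x^\top Qx$. *Comparison functions.* $\mathcal K$ is the class of continuous strictly increasing $\alpha:\mathbb R_{\ge0}\to\mathbb R_{\ge0}$ with $\alpha(0)=0$; $\mathcal K_\infty$ is the class of unbounded $\alpha\in\mathcal K$; $\mathcal{KL}$ is the class of $\beta:\mathbb R_{\ge0}\times\mathbb Z_{\ge0}\to\mathbb R_{\ge0}$ with $\beta(\cdot,k)\in\mathcal K$ for all $k$, and $\beta(s,\cdot)$ nonincreasing with limit $0$ for all $s$. *Model and constraints.* Let $\mathbb X\subseteq\mathbb R^n$ and $\mathbb Y\subseteq\mathbb R^{n_y}$ be closed, $\mathbb U\subseteq\mathbb R^{n_u}$ and $\mathbb D\subseteq\mathbb R^{n_d}$ compact, all containing the origin. Let $(f,h):\mathbb X\times\mathbb U\times\mathbb D\to\mathbb X\times\mathbb Y$, $g:\mathbb U\times\mathbb Y\to\mathbb R^{n_r}$ and $\bar c:\mathbb U\times\mathbb Y\to\mathbb R^{n_c}$ be continuous, with $f(0,0,0)=0$, $h(0,0,0)=0$, $g(0,0)=0$;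 let $\bar b\in\mathbb R^{n_c}_{>0}$ with $\bar c(0,0)+\bar b<0$ componentwise. *Steady-state target problem (SSTP).* Put $\bar{\mathbb Z}_y:=\{(u,y)\in\mathbb U\times\mathbb Y: \bar c(u,y)+\bar b\le0\}$, $$\mathcal Z_O(r,d):=\{(x,u)\in\mathbb X\times\mathbb U: x=f(x,u,d),\ (u,h(x,u,d))\in\bar{\mathbb Z}_y,\ r=g(u,h(x,u,d))\},$$ $\mathcal B:=\{\beta=(r_{sp},u_{sp},y_{sp},d): (u_{sp},y_{sp})\in\bar{\mathbb Z}_y,\ d\in\mathbb D,\ \mathcal Z_O(r_{sp},d)\ne\varnothing\}$; write $\beta=(s_{sp},d)$ with $s_{sp}=(r_{sp},u_{sp},y_{sp})$. Let $\ell_s:\mathbb R^{n_u}\times\mathbb R^{n_y}\to\mathbb R_{\ge0}$ be continuous and $V_s(x,u,\beta):=\ell_s(u-u_{sp},h(x,u,d)-y_{sp})$. Assume that for each $\beta\in\mathcal B$ either $\mathcal Z_O(r_{sp},d)$ is compact or $V_s(\cdot,\beta)$ is coercive in it (i.e. $V_s(z(k),\beta)\to\infty$ for every sequence $z(k)$ in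 $\mathcal Z_O(r_{sp},d)$ with $|z(k)|\to\infty$). Let $z_s=(x_s,u_s):\mathcal B\to\mathbb X\times\mathbb U$ be any selection of minimizers of $V_s(\cdot,\beta)$ over $\mathcal Z_O(r_{sp},d)$. *Regulator.* Let $N\ge1$, $c_f>0$, and let $\phi(k;x,\mathbf u,d)$ be the solution of $x^+=f(x,u,d)$. The costs are $$\ell(x,u,\beta)=|x-x_s(\beta)|_Q^2+|u-u_s(\beta)|_R^2+\sum_{i=1}^{n_c}w_i\max\{0,\bar c_i(u,h(x,u,d))\},\qquad V_f(x,\beta)=|x-x_s(\beta)|^2_{P_f(\beta)}$$ with $Q,R$ and every $P_f(\beta)$, $\beta\in\mathcal B$, symmetric positive definite and $w_i>0$. Put $\mathbb X_f(\beta):=\{x\in\mathbb X:V_f(x,\beta)\le c_f\}$, $\mathcal U_N(x,\beta):=\{\mathbf u\in\mathbb U^N:\phi(N;x,\mathbf u,d)\in\mathbb X_f(\beta)\}$, $\mathcal S_N:=\{(x,\beta)\in\mathbb X\times\mathcal B:\mathcal U_N(x,\beta)\ne\varnothing\}$, $$V_N(x,\mathbf u,\beta):=V_f(\phi(N;x,\mathbf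 u,d),\beta)+\sum_{k=0}^{N-1}\ell(\phi(k;x,\mathbf u,d),u(k),\beta),\qquad V_N^0(x,\beta):=\min_{\mathbf u\in\mathcal U_N(x,\beta)}V_N(x,\mathbf u,\beta)$$ ($V_N^0:=\infty$ if infeasible), and $\kappa_N(x,\beta):=u^0(0;x,\beta)$ for any selection $\mathbf u^0$ of minimizers on $\mathcal S_N$. Assume there is $\kappa_f:\mathbb X\times\mathcal B\to\mathbb U$ with $V_f(f(x,\kappa_f(x,\beta),d),\beta)-V_f(x,\beta)\le-\ell(x,\kappa_f(x,\beta),\beta)$ for all $\beta=(s_{sp},d)\in\mathcal B$, $x\in\mathbb X_f(\beta)$. *SSTP continuity.* Let $\mathcal B_c\subseteq\mathcal B$ be compact and $\delta_0>0$ such that $\hat{\mathcal B}_c:=\{(s,\hat d):(s,d)\in\mathcal B_c,\ |e_d|\le\delta_0,\ \hat d:=d-e_d\in\mathbb D\}\subseteq\mathcal B$ and $z_s$ is continuous on $\hat{\mathcal B}_c$. Assume also that $P_f$ is continuous on $\hat{\mathcal B}_c$. *Closed loop.* The lumped perturbation is $\tilde d=(e_x,e_d,e_x^+,e_d^+,\Delta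 s_{sp},w,w_d,v)$. With $\hat\beta=(s_{sp},\hat d)$ and $u=\kappa_N(\hat x,\hat\beta)$, the closed loop is $$\hat x^+=f(\hat x+e_x,u,\hat d+e_d)+w-e_x^+,\quad \hat\beta^+=(s_{sp}+\Delta s_{sp},\ \hat d+e_d+w_d-e_d^+),\quad y=h(\hat x+e_x,u,\hat d+e_d)+v,\quad r=g(u,y).$$ For $\delta>0$ let $\tilde{\mathbb D}_c^\delta(\hat x,\hat\beta)$ be the set of all $\tilde d$ with $|\tilde d|\le\delta$, $\hat x+e_x\in\mathbb X$, $\hat d+e_d\in\mathbb D$, $f(\hat x+e_x,u,\hat d+e_d)+w\in\mathbb X$, $\hat d+e_d+w_d\in\mathbb D$, $y\in\mathbb Y$, $\hat x^+\in\mathbb X$, $\hat d^+\in\mathbb D$ and $\hat\beta^+\in\hat{\mathcal B}_c$. Put $\delta\hat x:=\hat x-x_s(\hat\beta)$, $\delta r:=r-r_{sp}$ and $\hat{\mathcal S}_N^\rho:=\{(\hat x,\hat\beta)\in\mathcal S_N:V_N^0(\hat x,\hat\beta)\le\rho,\ \hat\beta\in\hat{\mathcal B}_c\}$. The closed loop is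 *RAS* on $\hat{\mathcal S}_N^\rho$ with respect to $(\zeta_1,\zeta_2)$ if there are $\beta_\zeta\in\mathcal{KL}$, $\gamma_\zeta\in\mathcal K$ with $|\zeta_1(k)|\le\beta_\zeta(|\zeta_2(0)|,k)+\gamma_\zeta(\max_{0\le i\le k}|\tilde d(i)|)$ for all $k\ge0$ and all closed-loop trajectories with $\tilde d(k)\in\tilde{\mathbb D}_c^\delta(\hat x(k),\hat\beta(k))$ that start in $\hat{\mathcal S}_N^\rho$; it is *RES* if moreover $\beta_\zeta(s,k)=c\lambda^ks$ for some $c>0$, $\lambda\in(0,1)$. *Conclusion.* For every $\rho>0$ there is $\delta>0$ such that: (a) $\hat{\mathcal S}_N^\rho$ is robustly positive invariant: it is closed, and $(\hat x,\hat\beta)\in\hat{\mathcal S}_N^\rho$, $\tilde d\in\tilde{\mathbb D}_c^\delta(\hat x,\hat\beta)$ imply $(\hat x^+,\hat\beta^+)\in\hat{\mathcal S}_N^\rho$; (b) there are $a_1,a_2,a_3>0$ and $\sigma_r\in\mathcal K_\infty$ such that, for all $(\hat x,\hat\beta)\in\hat{\mathcal S}_N^\rho$ and $\tilde d\in\tilde{\mathbb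 D}_c^\delta(\hat x,\hat\beta)$, $$a_1|\delta\hat x|^2\le V_N^0(\hat x,\hat\beta)\le a_2|\delta\hat x|^2,\qquad V_N^0(\hat x^+,\hat\beta^+)\le V_N^0(\hat x,\hat\beta)-a_3|\delta\hat x|^2+\sigma_r(|\tilde d|);$$ (c) the closed loop is RES on $\hat{\mathcal S}_N^\rho$ with respect to $(\delta\hat x,\delta\hat x)$; (d) the closed loop is RAS on $\hat{\mathcal S}_N^\rho$ with respect to $(\delta r,\delta\hat x)$; (e) if $g$ and $h$ are Lipschitz continuous on bounded subsets of their domains, then it is RES on $\hat{\mathcal S}_N^\rho$ with respect to $(\delta r,\delta\hat x)$. -/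

import Mathlib

open Set Filter Topology
open scoped Matrix

noncomputable section

namespace OffsetFree

/-- `ℝⁿ` with the Euclidean norm. -/
abbrev Vec (n : ℕ) := EuclideanSpace ℝ (Fin n)

/-- Setpoints `s_sp = (r_sp, u_sp, y_sp)`. -/
abbrev Setpoint (nr nu ny : ℕ) := Vec nr × Vec nu × Vec ny

/-- Parameters `β = (s_sp, d)` of the steady-state target problem. -/
abbrev Param (nr nu ny nd : ℕ) := Setpoint nr nu ny × Vec nd

/-! ### Comparison functions -/

/-- Class `𝒦`: continuous, strictly increasing on `[0, ∞)`, zero at zero (only the values on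
`[0, ∞)` matter). -/
def IsClassK (α : ℝ → ℝ) : Prop :=
  ContinuousOn α (Ici 0) ∧ StrictMonoOn α (Ici 0) ∧ α 0 = 0

/-- Class `𝒦∞`: unbounded functions of class `𝒦`. -/
def IsClassKInf (α : ℝ → ℝ) : Prop :=
  IsClassK α ∧ Tendsto α atTop atTop

/-- Class `𝒦ℒ`. -/
def IsClassKL (β : ℝ → ℕ → ℝ) : Prop :=
  (∀ k, IsClassK (fun s => β s k)) ∧
    ∀ s, 0 ≤ s → Antitone (β s) ∧ Tendsto (β s) atTop (𝓝 0)

/-! ### Robust invariance and stability of `ξ⁺ = F(ξ, ω)`, `ω ∈ Ω(ξ)` -/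

section Stability

variable {State Dist Out₁ Out₂ : Type*}

/-- `S` is closed and robustly positive invariant for `ξ⁺ = F(ξ, ω)`, `ω ∈ Ω(ξ)`. -/
def IsRPI [TopologicalSpace State] (F : State → Dist → State) (Ω : State → Set Dist)
    (S : Set State) : Prop :=
  IsClosed S ∧ ∀ ξ ∈ S, ∀ ω ∈ Ω ξ, F ξ ω ∈ S

/-- `(ξ, ω)` is a trajectory of `ξ⁺ = F(ξ, ω)`, `ω ∈ Ω(ξ)`. -/
def IsTrajectory (F : State → Dist → State) (Ω : State → Set Dist)
    (ξ : ℕ → State) (ω : ℕ → Dist) : Prop :=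
  ∀ k, ω k ∈ Ω (ξ k) ∧ ξ (k + 1) = F (ξ k) (ω k)

/-- `‖ω‖_{0:k} = max_{0 ≤ i ≤ k} |ω(i)|`. -/
def maxNorm [Norm Dist] (ω : ℕ → Dist) (k : ℕ) : ℝ :=
  (Finset.range (k + 1)).sup' ⟨0, by simp⟩ (fun i => ‖ω i‖)

/-- The estimate `|ζ₁(k)| ≤ b(|ζ₂(0)|, k) + γ(‖ω‖_{0:k})` along all trajectories that start in
`S`, where `ζᵢ = Gᵢ(ξ, ω)`. -/
def StabilityBound [Norm Dist] [Norm Out₁] [Norm Out₂]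
    (F : State → Dist → State) (Ω : State → Set Dist) (S : Set State)
    (G₁ : State → Dist → Out₁) (G₂ : State → Dist → Out₂)
    (b : ℝ → ℕ → ℝ) (γ : ℝ → ℝ) : Prop :=
  ∀ (ξ : ℕ → State) (ω : ℕ → Dist), IsTrajectory F Ω ξ ω → ξ 0 ∈ S →
    ∀ k, ‖G₁ (ξ k) (ω k)‖ ≤ b ‖G₂ (ξ 0) (ω 0)‖ k + γ (maxNorm ω k)

/-- Robust asymptotic stability on `S` with respect to the outputs `(G₁, G₂)`. -/
def IsRAS [Norm Dist] [Norm Out₁] [Norm Out₂]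
    (F : State → Dist → State) (Ω : State → Set Dist) (S : Set State)
    (G₁ : State → Dist → Out₁) (G₂ : State → Dist → Out₂) : Prop :=
  ∃ b γ, IsClassKL b ∧ IsClassK γ ∧ StabilityBound F Ω S G₁ G₂ b γ

/-- Robust exponential stability on `S` with respect to the outputs `(G₁, G₂)`. -/
def IsRES [Norm Dist] [Norm Out₁] [Norm Out₂]
    (F : State → Dist → State) (Ω : State → Set Dist) (S : Set State)
    (G₁ : State → Dist → Out₁) (G₂ : State → Dist → Out₂) : Prop :=
  ∃ (c lam : ℝ) (γ : ℝ → ℝ), 0 < c ∧ lam ∈ Ioo (0 : ℝ) 1 ∧ IsClassK γ ∧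
    StabilityBound F Ω S G₁ G₂ (fun s k => c * lam ^ k * s) γ

end Stability

/-- `φ`, with domain `A`, is Lipschitz continuous on bounded sets. -/
def LipschitzOnBounded {M M' : Type*} [PseudoMetricSpace M] [PseudoMetricSpace M']
    (φ : M → M') (A : Set M) : Prop :=
  ∀ B ⊆ A, Bornology.IsBounded B → ∃ K, LipschitzOnWith K φ B

/-- `|x|_Q² = xᵀ Q x`. -/
def wsq {n : ℕ} (Q : Matrix (Fin n) (Fin n) ℝ) (x : Vec n) : ℝ :=
  x.ofLp ⬝ᵥ (Q *ᵥ x.ofLp)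

/-! ### Offset-free model predictive control -/

/-- The data of the model, the constraints, the target problem and the regulator. Functions are
total; only their values on the constraint sets are used. -/
structure MPC (n nu ny nd nr nc : ℕ) where
  /-- state constraint set -/
  X : Set (Vec n)
  /-- input constraint set -/
  U : Set (Vec nu)
  /-- output constraint set -/
  Y : Set (Vec ny)
  /-- disturbance constraint set -/
  D : Set (Vec nd)
  /-- state map `f(x, u, d)` -/
  f : Vec n × Vec nu × Vec nd → Vec n
  /-- output map `h(x, u, d)` -/
  h : Vec n × Vec nu × Vec nd → Vec ny
  /-- reference map `g(u, y)` -/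
  g : Vec nu × Vec ny → Vec nr
  /-- input-output constraint function -/
  cbar : Vec nu × Vec ny → Fin nc → ℝ
  /-- back-off constants -/
  bbar : Fin nc → ℝ
  bbar_pos : ∀ i, 0 < bbar i
  /-- steady-state cost -/
  ls : Vec nu × Vec ny → ℝ
  /-- horizon length -/
  N : ℕ
  N_pos : 0 < N
  /-- stage cost `ℓ(x, u, β)` -/
  l : Vec n → Vec nu → Param nr nu ny nd → ℝ
  /-- terminal cost `V_f(x, β)` -/
  Vf : Vec n → Param nr nu ny nd → ℝ
  /-- terminal level -/
  cf : ℝ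
  cf_pos : 0 < cf

/-- The lumped perturbation `(e_x, e_d, e_x⁺, e_d⁺, Δs_sp, w, w_d, v)` with
`Δs_sp = (Δr_sp, Δu_sp, Δy_sp)`. -/
structure Pert (n nu ny nd nr : ℕ) where
  ex : Vec n
  ed : Vec nd
  exNext : Vec n
  edNext : Vec nd
  ds : Setpoint nr nu ny
  w : Vec n
  wd : Vec nd
  v : Vec ny

/-- The Euclidean norm of the stacked vector. -/
instance (n nu ny nd nr : ℕ) : Norm (Pert n nu ny nd nr) where
  norm p := √(‖p.ex‖ ^ 2 + ‖p.ed‖ ^ 2 + ‖p.exNext‖ ^ 2 + ‖p.edNext‖ ^ 2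
    + (‖p.ds.1‖ ^ 2 + ‖p.ds.2.1‖ ^ 2 + ‖p.ds.2.2‖ ^ 2)
    + ‖p.w‖ ^ 2 + ‖p.wd‖ ^ 2 + ‖p.v‖ ^ 2)

namespace MPC

variable {n nu ny nd nr nc : ℕ} (P : MPC n nu ny nd nr nc)

/-! #### Steady-state target problem -/

/-- The tightened input-output constraint set. -/
def Zybar : Set (Vec nu × Vec ny) :=
  {z | z.1 ∈ P.U ∧ z.2 ∈ P.Y ∧ ∀ i, P.cbar z i + P.bbar i ≤ 0}

/-- The offset-free steady-state pairs `𝒵_O(r, d)`. -/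
def ZO (r : Vec nr) (d : Vec nd) : Set (Vec n × Vec nu) :=
  {z | z.1 ∈ P.X ∧ z.2 ∈ P.U ∧ z.1 = P.f (z.1, z.2, d) ∧
    (z.2, P.h (z.1, z.2, d)) ∈ P.Zybar ∧ r = P.g (z.2, P.h (z.1, z.2, d))}

/-- The feasible parameters `ℬ` of the target problem. -/
def paramSet : Set (Param nr nu ny nd) :=
  {β | β.1.2 ∈ P.Zybar ∧ β.2 ∈ P.D ∧ (P.ZO β.1.1 β.2).Nonempty}

/-- The objective `V_s(x, u, β) = ℓ_s(u - u_sp, h(x, u, d) - y_sp)` of the target problem. -/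
def Vs (z : Vec n × Vec nu) (β : Param nr nu ny nd) : ℝ :=
  P.ls (z.2 - β.1.2.1, P.h (z.1, z.2, β.2) - β.1.2.2)

/-- `z_s = (x_s, u_s)` selects, for each feasible `β`, a solution of the target problem. -/
def IsTargetSelection (zs : Param nr nu ny nd → Vec n × Vec nu) : Prop :=
  ∀ β ∈ P.paramSet, zs β ∈ P.ZO β.1.1 β.2 ∧ ∀ z ∈ P.ZO β.1.1 β.2, P.Vs (zs β) β ≤ P.Vs z β

/-! #### Regulator -/

/-- The solution `φ(k; x, u, d)` of `x⁺ = f(x, u, d)` for `k ≤ N` (constant afterwards). -/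
def traj (x : Vec n) (u : Fin P.N → Vec nu) (d : Vec nd) : ℕ → Vec n
  | 0 => x
  | k + 1 => if hk : k < P.N then P.f (traj x u d k, u ⟨k, hk⟩, d) else traj x u d k

/-- The terminal set `𝕏_f(β)`. -/
def termSet (β : Param nr nu ny nd) : Set (Vec n) :=
  {x | x ∈ P.X ∧ P.Vf x β ≤ P.cf}

/-- The feasible input sequences `𝒰_N(x, β)`. -/
def feasInputs (x : Vec n) (β : Param nr nu ny nd) : Set (Fin P.N → Vec nu) :=
  {u | (∀ k, u k ∈ P.U) ∧ P.traj x u β.2 P.N ∈ P.termSet β}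

/-- The feasible state-parameter pairs `𝒮_N`. -/
def feasPairs : Set (Vec n × Param nr nu ny nd) :=
  {ξ | ξ.1 ∈ P.X ∧ ξ.2 ∈ P.paramSet ∧ (P.feasInputs ξ.1 ξ.2).Nonempty}

/-- The objective `V_N(x, u, β)` of the optimal control problem. -/
def VN (x : Vec n) (u : Fin P.N → Vec nu) (β : Param nr nu ny nd) : ℝ :=
  P.Vf (P.traj x u β.2 P.N) β + ∑ k : Fin P.N, P.l (P.traj x u β.2 k) (u k) β

/-- The optimal cost `V_N⁰(x, β)`; it is `⊤` if there is no feasible input sequence. -/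
def VN0 (x : Vec n) (β : Param nr nu ny nd) : EReal :=
  ⨅ u ∈ P.feasInputs x β, ((P.VN x u β : ℝ) : EReal)

/-- `u⁰` selects, for each feasible `(x, β)`, a solution of the optimal control problem. -/
def IsRegulatorSelection (u0 : Vec n → Param nr nu ny nd → Fin P.N → Vec nu) : Prop :=
  ∀ ξ ∈ P.feasPairs, u0 ξ.1 ξ.2 ∈ P.feasInputs ξ.1 ξ.2 ∧
    ∀ u ∈ P.feasInputs ξ.1 ξ.2, P.VN ξ.1 (u0 ξ.1 ξ.2) ξ.2 ≤ P.VN ξ.1 u ξ.2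

/-- The control law `κ_N(x, β) = u⁰(0; x, β)`. -/
def kappa (u0 : Vec n → Param nr nu ny nd → Fin P.N → Vec nu)
    (x : Vec n) (β : Param nr nu ny nd) : Vec nu :=
  u0 x β ⟨0, P.N_pos⟩

/-! #### Assumptions -/

/-- Continuity: `g : U × Y → ℝ^{n_r}` and `(f, h) : X × U × D → X × Y` are continuous, and they
vanish at the origin. -/
structure ContinuityAssumption : Prop where
  g_cont : ContinuousOn P.g (P.U ×ˢ P.Y)
  f_cont : ContinuousOn P.f (P.X ×ˢ P.U ×ˢ P.D)
  h_cont : ContinuousOn P.h (P.X ×ˢ P.U ×ˢ P.D)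
  f_maps : MapsTo P.f (P.X ×ˢ P.U ×ˢ P.D) P.X
  h_maps : MapsTo P.h (P.X ×ˢ P.U ×ˢ P.D) P.Y
  f_zero : P.f 0 = 0
  h_zero : P.h 0 = 0
  g_zero : P.g 0 = 0

/-- Constraints. -/
structure ConstraintAssumption : Prop where
  X_closed : IsClosed P.X
  Y_closed : IsClosed P.Y
  U_compact : IsCompact P.U
  D_compact : IsCompact P.D
  X_zero : 0 ∈ P.X
  Y_zero : 0 ∈ P.Y
  U_zero : 0 ∈ P.U
  D_zero : 0 ∈ P.D
  cbar_cont : ContinuousOn P.cbar (P.U ×ˢ P.Y)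
  cbar_zero : ∀ i, P.cbar 0 i + P.bbar i < 0

/-- Existence of solutions of the target problem: the cost `ℓ_s ≥ 0` is continuous and, for each
feasible `β`, the set `𝒵_O` is compact or `V_s(·, β)` is coercive in it. -/
structure TargetExistence : Prop where
  ls_nonneg : ∀ z, 0 ≤ P.ls z
  ls_cont : Continuous P.ls
  exist : ∀ β ∈ P.paramSet, IsCompact (P.ZO β.1.1 β.2) ∨
    ∀ z : ℕ → Vec n × Vec nu, (∀ k, z k ∈ P.ZO β.1.1 β.2) →
      Tendsto (fun k => ‖z k‖) atTop atTop → Tendsto (fun k => P.Vs (z k) β) atTop atTop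

/-- Terminal control law `κ_f : X × ℬ → U`. -/
def TerminalLaw : Prop :=
  ∃ κf : Vec n → Param nr nu ny nd → Vec nu,
    (∀ x ∈ P.X, ∀ β ∈ P.paramSet, κf x β ∈ P.U) ∧
    ∀ β ∈ P.paramSet, ∀ x ∈ P.termSet β,
      P.Vf (P.f (x, κf x β, β.2)) β - P.Vf x β ≤ - P.l x (κf x β) β

/-- Quadratic costs, with weights `Q`, `R`, `P_f(β)` and soft-constraint weights `w`. -/
structure QuadraticCosts (zs : Param nr nu ny nd → Vec n × Vec nu)
    (Q : Matrix (Fin n) (Fin n) ℝ) (R : Matrix (Fin nu) (Fin nu) ℝ)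
    (Pf : Param nr nu ny nd → Matrix (Fin n) (Fin n) ℝ) (w : Fin nc → ℝ) : Prop where
  Q_pos : Q.PosDef
  R_pos : R.PosDef
  Pf_pos : ∀ β ∈ P.paramSet, (Pf β).PosDef
  w_pos : ∀ i, 0 < w i
  stage : ∀ x ∈ P.X, ∀ u ∈ P.U, ∀ β ∈ P.paramSet,
    P.l x u β = wsq Q (x - (zs β).1) + wsq R (u - (zs β).2)
      + ∑ i, w i * max 0 (P.cbar (u, P.h (x, u, β.2)) i)
  terminal : ∀ x ∈ P.X, ∀ β ∈ P.paramSet, P.Vf x β = wsq (Pf β) (x - (zs β).1)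

/-- The enlarged parameter set
`{(s, d̂) | (s, d) ∈ ℬ_c, |e_d| ≤ δ₀, d̂ := d - e_d ∈ D}`. -/
def Bhat (Bc : Set (Param nr nu ny nd)) (δ₀ : ℝ) : Set (Param nr nu ny nd) :=
  {β | ∃ d ed : Vec nd, (β.1, d) ∈ Bc ∧ ‖ed‖ ≤ δ₀ ∧ β.2 = d - ed ∧ β.2 ∈ P.D}

/-- Continuity of the targets near a compact set `ℬ_c` of feasible parameters. -/
structure TargetContinuity (zs : Param nr nu ny nd → Vec n × Vec nu)
    (Bc : Set (Param nr nu ny nd)) (δ₀ : ℝ) : Prop where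
  Bc_compact : IsCompact Bc
  Bc_subset : Bc ⊆ P.paramSet
  delta_pos : 0 < δ₀
  Bhat_subset : P.Bhat Bc δ₀ ⊆ P.paramSet
  zs_cont : ContinuousOn zs (P.Bhat Bc δ₀)

/-! #### Closed-loop estimate error system, with state `ξ = (x̂, β̂)`, `β̂ = (s_sp, d̂)` -/

/-- The noises `(w, w_d, v)` that are admissible at `(x, u, d)`. -/
def noiseSet (x : Vec n) (u : Vec nu) (d : Vec nd) : Set (Vec n × Vec nd × Vec ny) :=
  {q | P.f (x, u, d) + q.1 ∈ P.X ∧ d + q.2.1 ∈ P.D ∧ P.h (x, u, d) + q.2.2 ∈ P.Y}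

/-- The perturbations that are admissible at `(x̂, u, d̂)`. The state `x = x̂ + e_x` and the
disturbance `d = d̂ + e_d` of the plant lie in `X` and `D`, where `f` and `h` are defined. -/
def pertSet (x : Vec n) (u : Vec nu) (d : Vec nd) : Set (Pert n nu ny nd nr) :=
  {p | x + p.ex ∈ P.X ∧ d + p.ed ∈ P.D ∧
    (p.w, p.wd, p.v) ∈ P.noiseSet (x + p.ex) u (d + p.ed) ∧
    P.f (x + p.ex, u, d + p.ed) + p.w - p.exNext ∈ P.X ∧
    d + p.ed + p.wd - p.edNext ∈ P.D}

/-- `β̂⁺ = (s_sp + Δs_sp, d̂ + e_d + w_d - e_d⁺)`. -/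
def paramNext (β : Param nr nu ny nd) (p : Pert n nu ny nd nr) : Param nr nu ny nd :=
  (β.1 + p.ds, β.2 + p.ed + p.wd - p.edNext)

variable (u0 : Vec n → Param nr nu ny nd → Fin P.N → Vec nu)

/-- `x̂⁺ = f(x̂ + e_x, κ_N(x̂, β̂), d̂ + e_d) + w - e_x⁺`. -/
def stateNext (x : Vec n) (β : Param nr nu ny nd) (p : Pert n nu ny nd nr) : Vec n :=
  P.f (x + p.ex, P.kappa u0 x β, β.2 + p.ed) + p.w - p.exNext

/-- The closed-loop map `(x̂, β̂) ↦ (x̂⁺, β̂⁺)`. -/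
def closedLoop (ξ : Vec n × Param nr nu ny nd) (p : Pert n nu ny nd nr) :
    Vec n × Param nr nu ny nd :=
  (P.stateNext u0 ξ.1 ξ.2 p, paramNext ξ.2 p)

/-- `y = h(x̂ + e_x, κ_N(x̂, β̂), d̂ + e_d) + v`. -/
def output (ξ : Vec n × Param nr nu ny nd) (p : Pert n nu ny nd nr) : Vec ny :=
  P.h (ξ.1 + p.ex, P.kappa u0 ξ.1 ξ.2, ξ.2.2 + p.ed) + p.v

/-- The setpoint-tracking error `δr = g(κ_N(x̂, β̂), y) - r_sp`. -/
def refError (ξ : Vec n × Param nr nu ny nd) (p : Pert n nu ny nd nr) : Vec nr :=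
  P.g (P.kappa u0 ξ.1 ξ.2, P.output u0 ξ p) - ξ.2.1.1

/-- The perturbations that are admissible in closed loop, keep `β̂⁺` in `ℬ̂_c`, and have norm at
most `δ`. -/
def closedLoopPert (Bc : Set (Param nr nu ny nd)) (δ₀ δ : ℝ)
    (ξ : Vec n × Param nr nu ny nd) : Set (Pert n nu ny nd nr) :=
  {p | p ∈ P.pertSet ξ.1 (P.kappa u0 ξ.1 ξ.2) ξ.2.2 ∧ paramNext ξ.2 p ∈ P.Bhat Bc δ₀ ∧
    ‖p‖ ≤ δ}

/-- The candidate domain of stability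
`{(x̂, β̂) ∈ 𝒮_N | V_N⁰(x̂, β̂) ≤ ρ, β̂ ∈ ℬ̂_c}`. -/
def domain (Bc : Set (Param nr nu ny nd)) (δ₀ ρ : ℝ) : Set (Vec n × Param nr nu ny nd) :=
  {ξ | ξ ∈ P.feasPairs ∧ P.VN0 ξ.1 ξ.2 ≤ (ρ : EReal) ∧ ξ.2 ∈ P.Bhat Bc δ₀}

end MPC

/-- The target-tracking error `δx̂ = x̂ - x_s(β̂)`. -/
def targetError {n nu ny nd nr : ℕ} (zs : Param nr nu ny nd → Vec n × Vec nu)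
    (ξ : Vec n × Param nr nu ny nd) (_p : Pert n nu ny nd nr) : Vec n :=
  ξ.1 - (zs ξ.2).1

end OffsetFree

end

/-! The optimal cost is a Lyapunov function for the target-tracking error. From below it dominates
the first stage cost, hence multiples of |x - x_s|² and |u - u_s|². From above, the terminal law
bounds it by V_f near the target, and away from the target the level ρ itself is at most a multiple
of |x - x_s|² (`exists_cost_bounds`). Shifting an optimal input sequence and appending the terminal
law gives the nominal descent (`exists_feasInputs_succ`).

Robustness does not rest on continuity of the optimal cost or of the control law, which may fail.
The shifted sequence is a competitor independent of the perturbation, and for a fixed sequence V_N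
is continuous in (x, β), uniformly over sequences by compactness (`exists_cost_modulus`). Two
margins absorb the perturbation: after the shift the terminal cost lies below c_f by a uniform
amount or more, so the competitor stays feasible; and the decrease is at least a fixed fraction of
the cost, so the level ρ is not exceeded (`exists_robust_descent`).

Descent and quadratic bounds yield an exponential estimate (`exists_exponential_bound`). The
setpoint r_sp is the value of g at the target, and the input error is controlled by the state error
through the cost bounds, so moduli of continuity of g and h transfer the estimate to δr
(`exists_refError_bound`, `output_bound`). General moduli give RAS; Lipschitz constants keep the
exponential rate. -/

noncomputable section

namespace OffsetFree

/-! ### Calculus of comparison functions -/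

namespace IsClassK

variable {α β : ℝ → ℝ}

lemma mono (hα : IsClassK α) {s t : ℝ} (hs : 0 ≤ s) (hst : s ≤ t) : α s ≤ α t :=
  hα.2.1.monotoneOn hs (hs.trans hst) hst

lemma nonneg (hα : IsClassK α) {s : ℝ} (hs : 0 ≤ s) : 0 ≤ α s := by
  simpa [hα.2.2] using hα.mono le_rfl hs

lemma add (hα : IsClassK α) (hβ : IsClassK β) : IsClassK (fun s => α s + β s) :=
  ⟨hα.1.add hβ.1, fun _ hs _ ht h => add_lt_add (hα.2.1 hs ht h) (hβ.2.1 hs ht h), by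
    simp [hα.2.2, hβ.2.2]⟩

lemma comp (hα : IsClassK α) (hβ : IsClassK β) : IsClassK (fun s => α (β s)) :=
  ⟨hα.1.comp hβ.1 fun _ hs => hβ.nonneg hs,
    fun _ hs _ ht h => hα.2.1 (hβ.nonneg hs) (hβ.nonneg ht) (hβ.2.1 hs ht h), by
    simp [hα.2.2, hβ.2.2]⟩

lemma linear {c : ℝ} (hc : 0 < c) : IsClassK (fun s => c * s) :=
  ⟨by fun_prop, fun _ _ _ _ h => mul_lt_mul_of_pos_left h hc, by simp⟩

lemma const_mul (hα : IsClassK α) {c : ℝ} (hc : 0 < c) : IsClassK (fun s => c * α s) :=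
  (linear hc).comp hα

lemma sqrt : IsClassK Real.sqrt :=
  ⟨Real.continuous_sqrt.continuousOn, fun _ hs _ _ h => Real.sqrt_lt_sqrt hs h, Real.sqrt_zero⟩

lemma exists_le (hα : IsClassK α) {ε : ℝ} (hε : 0 < ε) :
    ∃ δ > 0, ∀ s, 0 ≤ s → s ≤ δ → α s ≤ ε := by
  have h := Metric.continuousOn_iff.1 hα.1 0 self_mem_Ici ε hε
  obtain ⟨δ, hδ, h⟩ := h
  refine ⟨δ / 2, by positivity, fun s hs hsδ => ?_⟩
  have := h s hs (by rw [Real.dist_eq, sub_zero, abs_of_nonneg hs]; linarith)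
  rw [hα.2.2, Real.dist_eq, sub_zero] at this
  exact (le_abs_self _).trans this.le

/-- The sum is at most twice the larger summand. This weak triangle inequality later separates the
initial error from the perturbation. -/
lemma apply_add_le (hα : IsClassK α) {s t : ℝ} (hs : 0 ≤ s) (ht : 0 ≤ t) :
    α (s + t) ≤ α (2 * s) + α (2 * t) := by
  rcases le_total s t with h | h
  · have h1 := hα.mono (by positivity : 0 ≤ s + t) (by linarith : s + t ≤ 2 * t)
    have h2 := hα.nonneg (by positivity : 0 ≤ 2 * s)
    linarith
  · have h1 := hα.mono (by positivity : 0 ≤ s + t) (by linarith : s + t ≤ 2 * s)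
    have h2 := hα.nonneg (by positivity : 0 ≤ 2 * t)
    linarith

end IsClassK

namespace IsClassKInf

variable {α β : ℝ → ℝ}

lemma linear {c : ℝ} (hc : 0 < c) : IsClassKInf (fun s => c * s) :=
  ⟨.linear hc, tendsto_id.const_mul_atTop hc⟩

lemma add (hα : IsClassKInf α) (hβ : IsClassKInf β) : IsClassKInf (fun s => α s + β s) :=
  ⟨hα.1.add hβ.1, hα.2.atTop_add_atTop hβ.2⟩

lemma comp (hα : IsClassKInf α) (hβ : IsClassKInf β) : IsClassKInf (fun s => α (β s)) :=
  ⟨hα.1.comp hβ.1, hα.2.comp hβ.2⟩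

end IsClassKInf

/-- A `𝒦∞` function below prescribed affine functions that decrease to zero at zero. -/
lemma exists_isClassKInf_ge (b : ℕ → ℝ) (hb : ∀ n, 0 ≤ b n) :
    ∃ σ, IsClassKInf σ ∧ ∀ s, 0 ≤ s → ∀ c, (∀ n : ℕ, c ≤ 1 / ((n : ℝ) + 1) + b n * s) → c ≤ σ s := by
  -- An infimum of increasing affine functions is monotone and concave. Concavity gives continuity
  -- on the open half-line; at zero continuity comes from the intercepts 1/(n+1) → 0.
  set τ : ℝ → ℝ := fun s => ⨅ n : ℕ, (1 / ((n : ℝ) + 1) + b n * s) with hτ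
  have hbdd : ∀ s, 0 ≤ s → BddBelow (range fun n : ℕ => 1 / ((n : ℝ) + 1) + b n * s) := by
    rintro s hs
    refine ⟨0, ?_⟩
    rintro _ ⟨n, rfl⟩
    have := hb n
    positivity
  have hle : ∀ s, 0 ≤ s → ∀ n : ℕ, τ s ≤ 1 / ((n : ℝ) + 1) + b n * s := fun s hs n =>
    ciInf_le (hbdd s hs) n
  have hnonneg : ∀ s, 0 ≤ s → 0 ≤ τ s := fun s hs => le_ciInf fun n => by
    have := hb n
    positivity
  have hmono : MonotoneOn τ (Ici 0) := fun s hs t ht hst => le_ciInf fun n =>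
    (hle s hs n).trans (by have := mul_le_mul_of_nonneg_left hst (hb n); linarith)
  have hconc : ConcaveOn ℝ (Ioi 0) τ := by
    refine ⟨convex_Ioi 0, fun x hx y hy p q hp hq hpq => le_ciInf fun n => ?_⟩
    have h1 := mul_le_mul_of_nonneg_left (hle x (le_of_lt hx) n) hp
    have h2 := mul_le_mul_of_nonneg_left (hle y (le_of_lt hy) n) hq
    simp only [smul_eq_mul]
    calc p * τ x + q * τ y
        ≤ p * (1 / ((n : ℝ) + 1) + b n * x) + q * (1 / ((n : ℝ) + 1) + b n * y) := add_le_add h1 h2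
      _ = (p + q) * (1 / ((n : ℝ) + 1)) + b n * (p * x + q * y) := by ring
      _ = _ := by rw [hpq, one_mul]
  have hzero : τ 0 = 0 := by
    refine le_antisymm (le_of_forall_pos_le_add fun ε hε => ?_) (hnonneg 0 le_rfl)
    obtain ⟨n, hn⟩ := exists_nat_one_div_lt hε
    have := hle 0 le_rfl n
    linarith
  have hcont : ContinuousOn τ (Ici 0) := by
    intro s hs
    rcases (mem_Ici.1 hs).eq_or_lt with rfl | hs
    · rw [Metric.continuousWithinAt_iff]
      intro ε hε
      obtain ⟨n, hn⟩ := exists_nat_one_div_lt (half_pos hε)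
      -- The slope `b n` may vanish, so the radius is divided by `b n + 1`.
      have hb1 : 0 < b n + 1 := by linarith [hb n]
      refine ⟨ε / 2 / (b n + 1), by positivity, fun {t} ht hd => ?_⟩
      rw [Real.dist_eq, sub_zero, abs_of_nonneg ht, lt_div_iff₀ hb1] at hd
      rw [hzero, Real.dist_eq, sub_zero, abs_of_nonneg (hnonneg t ht)]
      have := hle t ht n
      have ht : (0 : ℝ) ≤ t := ht
      nlinarith
    · exact ((hconc.continuousOn isOpen_Ioi).continuousAt (Ioi_mem_nhds hs)).continuousWithinAt
  -- Adding the identity makes the function strictly increasing and unbounded.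
  refine ⟨fun s => τ s + s, ⟨⟨hcont.add continuousOn_id, fun s hs t ht hst => ?_, by simp [hzero]⟩,
    ?_⟩, fun s hs c hc => (le_ciInf hc).trans (le_add_of_nonneg_right hs)⟩
  · have := hmono hs ht hst.le
    dsimp only
    linarith
  · refine tendsto_atTop_mono' _ ?_ tendsto_id
    filter_upwards [eventually_ge_atTop 0] with s hs
    simpa using hnonneg s hs

/-- A continuous function on a compact set has a modulus of continuity of class `𝒦∞`. -/
lemma exists_modulus {M M' : Type*} [PseudoMetricSpace M] [PseudoMetricSpace M'] {φ : M → M'}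
    {C : Set M} (hC : IsCompact C) (hφ : ContinuousOn φ C) :
    ∃ σ, IsClassKInf σ ∧ ∀ a ∈ C, ∀ b ∈ C, dist (φ a) (φ b) ≤ σ (dist a b) := by
  have hu := Metric.uniformContinuousOn_iff.1 (hC.uniformContinuousOn_of_continuous hφ)
  choose! δ hδ h using fun n : ℕ => hu (1 / ((n : ℝ) + 1)) (by positivity)
  obtain ⟨K, hK⟩ := Metric.isBounded_iff.1 (hC.image_of_continuousOn hφ).isBounded
  -- For each n, points closer than `δ n` have images within 1/(n+1); for the others the diameter
  -- bound `|K|` is at most `|K| / δ n` times the distance. Each n thus contributes an affine bound.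
  obtain ⟨σ, hσ, hle⟩ := exists_isClassKInf_ge (fun n => |K| / δ n) fun n =>
    div_nonneg (abs_nonneg _) (hδ n).le
  refine ⟨σ, hσ, fun a ha b hb => hle _ dist_nonneg _ fun n => ?_⟩
  rcases lt_or_ge (dist a b) (δ n) with hab | hab
  · have h1 := (h n a ha b hb hab).le
    have h2 : 0 ≤ |K| / δ n * dist a b :=
      mul_nonneg (div_nonneg (abs_nonneg _) (hδ n).le) dist_nonneg
    linarith
  · have h1 := (hK (mem_image_of_mem φ ha) (mem_image_of_mem φ hb)).trans (le_abs_self K)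
    have h2 : |K| ≤ |K| / δ n * dist a b := by
      rw [div_mul_eq_mul_div, le_div_iff₀ (hδ n)]
      exact mul_le_mul_of_nonneg_left hab (abs_nonneg _)
    have h3 : 0 ≤ 1 / ((n : ℝ) + 1) := by positivity
    linarith

/-! ### Lyapunov functions for robust stability -/

lemma norm_le_maxNorm {Dist : Type*} [Norm Dist] (ω : ℕ → Dist) {i k : ℕ} (h : i ≤ k) :
    ‖ω i‖ ≤ maxNorm ω k :=
  Finset.le_sup' (fun i => ‖ω i‖) (Finset.mem_range.2 (Nat.lt_succ_of_le h))

lemma IsTrajectory.mem {State Dist : Type*} {F : State → Dist → State} {Ω : State → Set Dist}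
    {S : Set State} {ξ : ℕ → State} {ω : ℕ → Dist} (h : IsTrajectory F Ω ξ ω)
    (hS : ∀ ξ ∈ S, ∀ ω ∈ Ω ξ, F ξ ω ∈ S) (h0 : ξ 0 ∈ S) (k : ℕ) : ξ k ∈ S := by
  induction k with
  | zero => exact h0
  | succ k ih => rw [(h k).2]; exact hS _ ih _ (h k).1

section Stability

variable {State Dist Out Out' : Type*} [Norm Dist] {F : State → Dist → State} {Ω : State → Set Dist}
  {S : Set State}

/-- A quadratically bounded robust Lyapunov function yields an exponential estimate. -/
lemma exists_exponential_bound [SeminormedAddCommGroup Out]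
    (hS : ∀ ξ ∈ S, ∀ ω ∈ Ω ξ, F ξ ω ∈ S) (hΩ : ∀ (ξ : State), ∀ ω ∈ Ω ξ, 0 ≤ ‖ω‖)
    {V : State → ℝ} {e : State → Out}
    {a₁ a₂ a₃ : ℝ} {σ : ℝ → ℝ} (h₁ : 0 < a₁) (h₂ : 0 < a₂) (h₃ : 0 < a₃) (h₃₂ : a₃ < a₂)
    (hσ : IsClassK σ) (hlow : ∀ ξ ∈ S, a₁ * ‖e ξ‖ ^ 2 ≤ V ξ) (hup : ∀ ξ ∈ S, V ξ ≤ a₂ * ‖e ξ‖ ^ 2)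
    (hdec : ∀ ξ ∈ S, ∀ ω ∈ Ω ξ, V (F ξ ω) ≤ V ξ - a₃ * ‖e ξ‖ ^ 2 + σ ‖ω‖) :
    ∃ (c lam : ℝ) (γ : ℝ → ℝ), 0 < c ∧ lam ∈ Ioo (0 : ℝ) 1 ∧ IsClassK γ ∧
      StabilityBound F Ω S (fun ξ _ => e ξ) (fun ξ _ => e ξ) (fun s k => c * lam ^ k * s) γ := by
  -- By the upper bound, a₃|e|² is at least the fraction a₃/a₂ of V. The strict inequality a₃ < a₂
  -- keeps μ positive.
  set μ := 1 - a₃ / a₂ with hμ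
  have hr : 0 < a₃ / a₂ := by positivity
  have hr1 : a₃ / a₂ < 1 := (div_lt_one h₂).2 h₃₂
  have hμ0 : 0 < μ := by linarith
  have hμ1 : μ < 1 := by linarith
  have hstep : ∀ ξ ∈ S, ∀ ω ∈ Ω ξ, V (F ξ ω) ≤ μ * V ξ + σ ‖ω‖ := by
    intro ξ hξ ω hω
    have h := mul_le_mul_of_nonneg_left (hup ξ hξ) hr.le
    have h' : a₃ / a₂ * (a₂ * ‖e ξ‖ ^ 2) = a₃ * ‖e ξ‖ ^ 2 := by field_simp
    have := hdec ξ hξ ω hω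
    rw [hμ]
    linarith
  refine ⟨√(a₂ / a₁), √μ, fun s => √(1 / (a₁ * (1 - μ)) * σ s), by positivity,
    ⟨by positivity, by rw [Real.sqrt_lt' one_pos]; simpa using hμ1⟩,
    IsClassK.sqrt.comp (hσ.const_mul ?_), ?_⟩
  · have : 0 < 1 - μ := by linarith
    positivity
  intro ξ ω hξ h0 k
  have hmem := hξ.mem hS h0
  have hω : ∀ k, 0 ≤ ‖ω k‖ := fun k => hΩ _ _ (hξ k).1
  -- With k fixed, the perturbation term is constant in j, and σ/(1-μ) is the fixed point of t ↦ μt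
  -- + σ.
  have hV : ∀ j, j ≤ k → V (ξ j) ≤ μ ^ j * V (ξ 0) + σ (maxNorm ω k) / (1 - μ) := by
    intro j
    have hm : 0 ≤ σ (maxNorm ω k) :=
      hσ.nonneg ((hω 0).trans (norm_le_maxNorm ω (Nat.zero_le k)))
    have h1μ : 0 < 1 - μ := by linarith
    induction j with
    | zero => intro _; have : 0 ≤ σ (maxNorm ω k) / (1 - μ) := by positivity
              simpa using this
    | succ j ih =>
      intro hj
      have h1 := hstep _ (hmem j) _ (hξ j).1
      rw [← (hξ j).2] at h1
      have h2 := mul_le_mul_of_nonneg_left (ih (by omega)) hμ0.le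
      have h3 := hσ.mono (hω j) (norm_le_maxNorm ω (by omega : j ≤ k))
      have h4 : μ * (σ (maxNorm ω k) / (1 - μ)) + σ (maxNorm ω k) = σ (maxNorm ω k) / (1 - μ) := by
        field_simp
        ring
      rw [pow_succ]
      linarith
  have hk := (hlow _ (hmem k)).trans (hV k le_rfl)
  have h0' := mul_le_mul_of_nonneg_left (hup _ h0) (pow_pos hμ0 k).le
  have h1μ : 0 < 1 - μ := by linarith
  have hsq : ‖e (ξ k)‖ ^ 2 ≤ (√(a₂ / a₁) * √μ ^ k * ‖e (ξ 0)‖) ^ 2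
      + 1 / (a₁ * (1 - μ)) * σ (maxNorm ω k) := by
    rw [mul_pow, mul_pow, Real.sq_sqrt (by positivity), ← pow_mul, mul_comm k, pow_mul,
      Real.sq_sqrt hμ0.le, ← mul_le_mul_iff_right₀ h₁]
    calc a₁ * ‖e (ξ k)‖ ^ 2 ≤ μ ^ k * (a₂ * ‖e (ξ 0)‖ ^ 2) + σ (maxNorm ω k) / (1 - μ) := by linarith
      _ = _ := by field_simp
  have hB : 0 ≤ 1 / (a₁ * (1 - μ)) * σ (maxNorm ω k) :=
    mul_nonneg (by positivity) (hσ.nonneg ((hω 0).trans (norm_le_maxNorm ω (Nat.zero_le k))))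
  -- The square root of p² + q is at most p + √q, because the cross term in the square is
  -- nonnegative.
  refine (pow_le_pow_iff_left₀ (norm_nonneg _) (by positivity) two_ne_zero).1 (hsq.trans ?_)
  rw [add_sq, Real.sq_sqrt hB]
  have : 0 ≤ 2 * (√(a₂ / a₁) * √μ ^ k * ‖e (ξ 0)‖) * √(1 / (a₁ * (1 - μ)) * σ (maxNorm ω k)) := by
    positivity
  linarith

section Output

variable [SeminormedAddCommGroup Out] [SeminormedAddCommGroup Out'] {e : State → Out}
  {G : State → Dist → Out'} {c lam : ℝ} {γ τ : ℝ → ℝ}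

/-- An exponential estimate for `e` carries over to outputs that are bounded in terms of `e`. -/
lemma output_bound (hS : ∀ ξ ∈ S, ∀ ω ∈ Ω ξ, F ξ ω ∈ S) (hΩ : ∀ (ξ : State), ∀ ω ∈ Ω ξ, 0 ≤ ‖ω‖)
    (hc : 0 < c) (hlam : 0 < lam) (hγ : IsClassK γ)
    (hbound : StabilityBound F Ω S (fun ξ _ => e ξ) (fun ξ _ => e ξ)
      (fun s k => c * lam ^ k * s) γ)
    (hτ : IsClassK τ) (hG : ∀ ξ ∈ S, ∀ ω ∈ Ω ξ, ‖G ξ ω‖ ≤ τ (‖e ξ‖ + ‖ω‖)) :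
    StabilityBound F Ω S G (fun ξ _ => e ξ) (fun s k => τ (2 * (c * lam ^ k * s)))
      (fun s => τ (2 * (γ s + 1 * s))) := by
  intro ξ ω hξ h0 k
  have hω : ∀ k, 0 ≤ ‖ω k‖ := fun k => hΩ _ _ (hξ k).1
  have hm := norm_le_maxNorm ω (le_refl k)
  have hm0 := (hω k).trans hm
  refine (hG _ (hξ.mem hS h0 k) _ (hξ k).1).trans ?_
  have h1 : ‖e (ξ k)‖ ≤ c * lam ^ k * ‖e (ξ 0)‖ + γ (maxNorm ω k) := hbound ξ ω hξ h0 k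
  refine (hτ.mono (add_nonneg (norm_nonneg _) (hω k)) (?_ : _ ≤ c * lam ^ k * ‖e (ξ 0)‖ +
    (γ (maxNorm ω k) + 1 * maxNorm ω k))).trans (hτ.apply_add_le (by positivity)
      (add_nonneg (hγ.nonneg hm0) (by linarith)))
  linarith

/-- A class-𝒦 gain may destroy the exponential rate, but its composition with a vanishing geometric
sequence is still of class 𝒦ℒ. -/
lemma IsRAS.of_exponential_bound (hS : ∀ ξ ∈ S, ∀ ω ∈ Ω ξ, F ξ ω ∈ S)
    (hΩ : ∀ (ξ : State), ∀ ω ∈ Ω ξ, 0 ≤ ‖ω‖)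
    (hc : 0 < c) (hlam : lam ∈ Ioo (0 : ℝ) 1) (hγ : IsClassK γ)
    (hbound : StabilityBound F Ω S (fun ξ _ => e ξ) (fun ξ _ => e ξ)
      (fun s k => c * lam ^ k * s) γ)
    (hτ : IsClassK τ) (hG : ∀ ξ ∈ S, ∀ ω ∈ Ω ξ, ‖G ξ ω‖ ≤ τ (‖e ξ‖ + ‖ω‖)) :
    IsRAS F Ω S G (fun ξ _ => e ξ) := by
  refine ⟨_, _, ⟨fun k => ?_, fun s hs => ⟨fun i j hij => ?_, ?_⟩⟩, ?_,
    output_bound hS hΩ hc hlam.1 hγ hbound hτ hG⟩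
  · have : 0 < c * lam ^ k := mul_pos hc (pow_pos hlam.1 k)
    exact hτ.comp ((IsClassK.linear two_pos).comp (IsClassK.linear this))
  · have := hlam.1
    refine hτ.mono (by positivity) ?_
    have := pow_le_pow_of_le_one hlam.1.le hlam.2.le hij
    gcongr
  -- The limit is taken within [0, ∞), since τ is continuous only there.
  · have h1 : Tendsto (fun k : ℕ => 2 * (c * lam ^ k * s)) atTop (𝓝[Ici 0] 0) := by
      refine tendsto_nhdsWithin_iff.2 ⟨?_, Eventually.of_forall fun k => ?_⟩
      · have := (((tendsto_pow_atTop_nhds_zero_of_lt_one hlam.1.le hlam.2).const_mul c).mul_const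
          s).const_mul 2
        simpa using this
      · have := hlam.1
        exact mem_Ici.2 (by positivity)
    have h2 : Tendsto τ (𝓝[Ici 0] 0) (𝓝 (τ 0)) := hτ.1 0 self_mem_Ici
    rw [hτ.2.2] at h2
    exact h2.comp h1
  · exact hτ.comp ((IsClassK.linear two_pos).comp (hγ.add (IsClassK.linear one_pos)))

/-- A linear gain commutes with the geometric factor, so the same rate `lam` survives. -/
lemma IsRES.of_exponential_bound (hS : ∀ ξ ∈ S, ∀ ω ∈ Ω ξ, F ξ ω ∈ S)
    (hΩ : ∀ (ξ : State), ∀ ω ∈ Ω ξ, 0 ≤ ‖ω‖)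
    (hc : 0 < c) (hlam : lam ∈ Ioo (0 : ℝ) 1) (hγ : IsClassK γ)
    (hbound : StabilityBound F Ω S (fun ξ _ => e ξ) (fun ξ _ => e ξ)
      (fun s k => c * lam ^ k * s) γ)
    {L : ℝ} (hL : 0 < L) (hG : ∀ ξ ∈ S, ∀ ω ∈ Ω ξ, ‖G ξ ω‖ ≤ L * (‖e ξ‖ + ‖ω‖)) :
    IsRES F Ω S G (fun ξ _ => e ξ) := by
  refine ⟨L * 2 * c, lam, fun s => L * (2 * (γ s + 1 * s)), by positivity, hlam, ?_, fun ξ ω hξ h0 k =>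
    (output_bound hS hΩ hc hlam.1 hγ hbound (IsClassK.linear hL) hG ξ ω hξ h0 k).trans_eq ?_⟩
  · exact (IsClassK.linear hL).comp
      ((IsClassK.linear two_pos).comp (hγ.add (IsClassK.linear one_pos)))
  · dsimp only
    ring

end Output

end Stability

/-! ### Weighted squares -/

lemma continuous_wsq {n : ℕ} :
    Continuous fun z : Matrix (Fin n) (Fin n) ℝ × Vec n => wsq z.1 z.2 := by
  unfold wsq
  have h : Continuous fun z : Matrix (Fin n) (Fin n) ℝ × Vec n => z.2.ofLp :=
    (PiLp.continuous_ofLp 2 _).comp continuous_snd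
  exact h.dotProduct (continuous_fst.matrix_mulVec h)

lemma wsq_smul {n : ℕ} (Q : Matrix (Fin n) (Fin n) ℝ) (c : ℝ) (x : Vec n) :
    wsq Q (c • x) = c ^ 2 * wsq Q x := by
  simp only [wsq, WithLp.ofLp_smul, Matrix.mulVec_smul, dotProduct_smul, smul_dotProduct,
    smul_eq_mul]
  ring

lemma wsq_zero {n : ℕ} (Q : Matrix (Fin n) (Fin n) ℝ) : wsq Q 0 = 0 := by
  simp [wsq]

lemma wsq_pos {n : ℕ} {Q : Matrix (Fin n) (Fin n) ℝ} (hQ : Q.PosDef) {x : Vec n} (hx : x ≠ 0) :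
    0 < wsq Q x := by
  have h : x.ofLp ≠ 0 := fun h => hx (by ext i; simp [h])
  simpa [wsq] using hQ.dotProduct_mulVec_pos h

/-- Positive definite weights that depend continuously on a parameter in a compact set are bounded
below and above by multiples of the Euclidean norm. -/
lemma exists_wsq_bounds {n : ℕ} {T : Type*} [TopologicalSpace T] {B : Set T} (hB : IsCompact B)
    {M : T → Matrix (Fin n) (Fin n) ℝ} (hM : ContinuousOn M B) (hpos : ∀ t ∈ B, (M t).PosDef) :
    ∃ p q : ℝ, 0 < p ∧ 0 < q ∧
      ∀ t ∈ B, ∀ x, p * ‖x‖ ^ 2 ≤ wsq (M t) x ∧ wsq (M t) x ≤ q * ‖x‖ ^ 2 := by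
  -- By homogeneity of degree two it suffices to bound the form on the unit sphere, jointly with the
  -- parameter. This product may be empty, for instance when n = 0.
  have hC : IsCompact (B ×ˢ Metric.sphere (0 : Vec n) 1) := hB.prod (isCompact_sphere 0 1)
  have hcont : ContinuousOn (fun z : T × Vec n => wsq (M z.1) z.2)
      (B ×ˢ Metric.sphere (0 : Vec n) 1) :=
    continuous_wsq.comp_continuousOn
      ((hM.comp continuousOn_fst fun z hz => hz.1).prodMk continuousOn_snd)
  have hp : ∃ p : ℝ, 0 < p ∧ ∀ z ∈ B ×ˢ Metric.sphere (0 : Vec n) 1, p ≤ wsq (M z.1) z.2 := by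
    rcases (B ×ˢ Metric.sphere (0 : Vec n) 1).eq_empty_or_nonempty with he | hne
    · exact ⟨1, one_pos, by simp [he]⟩
    · obtain ⟨z, hz, hmin⟩ := hC.exists_isMinOn hne hcont
      exact ⟨_, wsq_pos (hpos _ hz.1) (ne_zero_of_mem_unit_sphere ⟨z.2, hz.2⟩), fun y hy => hmin hy⟩
  obtain ⟨p, hp, hpz⟩ := hp
  obtain ⟨q, hq⟩ := hC.bddAbove_image hcont
  -- An upper bound of a possibly empty set carries no sign, hence the maximum with 1.
  refine ⟨p, max q 1, hp, by positivity, fun t ht x => ?_⟩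
  rcases eq_or_ne x 0 with rfl | hx
  · simp [wsq_zero]
  have hx0 : 0 < ‖x‖ := norm_pos_iff.2 hx
  have hmem : (t, ‖x‖⁻¹ • x) ∈ B ×ˢ Metric.sphere (0 : Vec n) 1 :=
    ⟨ht, by simp [norm_smul, hx0.ne']⟩
  have h1 := hpz _ hmem
  have h2 : _ ≤ q := hq (mem_image_of_mem _ hmem)
  have h2 := h2.trans (le_max_left q 1)
  have hxx : wsq (M t) x = ‖x‖ ^ 2 * wsq (M t) (‖x‖⁻¹ • x) := by
    rw [wsq_smul]; field_simp
  rw [hxx, mul_comm p, mul_comm (max q 1)]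
  exact ⟨by gcongr, by gcongr⟩

namespace MPC

variable {n nu ny nd nr nc : ℕ} (P : MPC n nu ny nd nr nc)

/-! ### Trajectories under input signals on `ℕ` -/

/-- The solution of `x⁺ = f(x, v, d)` for an input signal on `ℕ`. -/
def roll (d : Vec nd) (v : ℕ → Vec nu) (x : Vec n) : ℕ → Vec n
  | 0 => x
  | k + 1 => P.f (roll d v x k, v k, d)

/-- Peeling off the first step instead of the last identifies the tail of a solution with the
solution for the shifted input. -/
lemma roll_succ' (d : Vec nd) (v : ℕ → Vec nu) (x : Vec n) (k : ℕ) :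
    P.roll d v x (k + 1) = P.roll d (fun i => v (i + 1)) (P.f (x, v 0, d)) k := by
  induction k with
  | zero => rfl
  | succ k ih => rw [roll, ih, roll]

/-- The two agree only up to the horizon, after which `traj` stays constant. -/
lemma traj_eq_roll (d : Vec nd) (v : ℕ → Vec nu) (x : Vec n) {k : ℕ} (hk : k ≤ P.N) :
    P.traj x (fun i => v i) d k = P.roll d v x k := by
  induction k with
  | zero => rfl
  | succ k ih => rw [traj, dif_pos (Nat.lt_of_succ_le hk), ih (by omega), roll]

lemma VN_eq_roll (v : ℕ → Vec nu) (x : Vec n) (β : Param nr nu ny nd) :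
    P.VN x (fun i => v i) β = P.Vf (P.roll β.2 v x P.N) β +
      ∑ k ∈ Finset.range P.N, P.l (P.roll β.2 v x k) (v k) β := by
  rw [VN, P.traj_eq_roll β.2 v x le_rfl,
    Finset.sum_range fun k => P.l (P.roll β.2 v x k) (v k) β]
  congr 1
  exact Finset.sum_congr rfl fun k _ => by rw [P.traj_eq_roll β.2 v x k.2.le]

variable {P}

lemma traj_mem (hf : MapsTo P.f (P.X ×ˢ P.U ×ˢ P.D) P.X) {d : Vec nd} (hd : d ∈ P.D)
    {u : Fin P.N → Vec nu} (hu : ∀ k, u k ∈ P.U) {x : Vec n} (hx : x ∈ P.X) (k : ℕ) :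
    P.traj x u d k ∈ P.X := by
  induction k with
  | zero => exact hx
  | succ k ih =>
    rw [traj]
    split_ifs with hk
    · exact hf ⟨ih, hu _, hd⟩
    · exact ih

/-- The terminal control law keeps the terminal set invariant and bounds the cost from there. -/
lemma exists_feasInputs_of_mem_termSet (hf : MapsTo P.f (P.X ×ˢ P.U ×ˢ P.D) P.X)
    (hterm : P.TerminalLaw) {β : Param nr nu ny nd} (hβ : β ∈ P.paramSet)
    (hl : ∀ x ∈ P.X, ∀ u ∈ P.U, 0 ≤ P.l x u β) {x : Vec n} (hx : x ∈ P.termSet β) :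
    ∃ u ∈ P.feasInputs x β, P.VN x u β ≤ P.Vf x β := by
  obtain ⟨κ, hκ, hdec⟩ := hterm
  let z : ℕ → Vec n := fun k => Nat.rec x (fun _ y => P.f (y, κ y β, β.2)) k
  have hz : ∀ k, z (k + 1) = P.f (z k, κ (z k) β, β.2) := fun _ => rfl
  have hmem : ∀ k, z k ∈ P.termSet β := by
    intro k
    induction k with
    | zero => exact hx
    | succ k ih =>
      have hu := hκ _ ih.1 β hβ
      refine ⟨hf ⟨ih.1, hu, hβ.2.1⟩, ?_⟩
      have h1 := hdec β hβ _ ih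
      have h2 := hl _ ih.1 _ hu
      have h3 := ih.2
      rw [hz]
      linarith
  have hroll : ∀ k, P.roll β.2 (fun k => κ (z k) β) x k = z k := by
    intro k
    induction k with
    | zero => rfl
    | succ k ih => rw [roll, ih, hz]
  refine ⟨fun i => κ (z i) β, ⟨fun k => hκ _ (hmem _).1 β hβ, ?_⟩, ?_⟩
  · rw [P.traj_eq_roll β.2 (fun k => κ (z k) β) x le_rfl, hroll]
    exact hmem _
  · rw [P.VN_eq_roll (fun k => κ (z k) β) x β]
    simp only [hroll]
    -- Terminal cost plus accumulated stage cost along `z` does not increase with the horizon, so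
    -- the bound telescopes for any horizon.
    induction P.N with
    | zero => simp [z]
    | succ k ih =>
      rw [Finset.sum_range_succ]
      have := hdec β hβ _ (hmem k)
      rw [← hz] at this
      linarith

/-- The shifted input sequence, completed by the terminal control law, is feasible at the nominal
successor state and decreases the cost by the first stage cost. -/
lemma exists_feasInputs_succ (hterm : P.TerminalLaw) {β : Param nr nu ny nd} (hβ : β ∈ P.paramSet)
    {x : Vec n} {u : Fin P.N → Vec nu} (hu : u ∈ P.feasInputs x β) :
    ∃ v : Fin P.N → Vec nu, (∀ k, v k ∈ P.U) ∧
      P.VN (P.f (x, u ⟨0, P.N_pos⟩, β.2)) v β ≤ P.VN x u β - P.l x (u ⟨0, P.N_pos⟩) β ∧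
      ∃ z ∈ P.termSet β, ∃ a ∈ P.U,
        P.Vf (P.traj (P.f (x, u ⟨0, P.N_pos⟩, β.2)) v β.2 P.N) β ≤ P.Vf z β - P.l z a β := by
  obtain ⟨κ, hκ, hdec⟩ := hterm
  set z := P.traj x u β.2 P.N with hz
  have hzT : z ∈ P.termSet β := hu.2
  have ha := hκ z hzT.1 β hβ
  -- Index `P.N` holds the appended terminal input; after the shift by one it becomes the last input
  -- of the new sequence.
  let v : ℕ → Vec nu := fun k => if h : k < P.N then u ⟨k, h⟩ else κ z β
  have hvU : ∀ k, v k ∈ P.U := by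
    intro k
    by_cases h : k < P.N
    · simpa [v, h] using hu.1 _
    · simpa [v, h] using ha
  have hvu : (fun i : Fin P.N => v i) = u := by
    ext1 i
    simp [v]
  have hv0 : v 0 = u ⟨0, P.N_pos⟩ := by simp [v, P.N_pos]
  have hvN : v P.N = κ z β := by simp [v]
  have hzr : P.roll β.2 v x P.N = z := by rw [← P.traj_eq_roll β.2 v x le_rfl, hvu]
  have hend : P.roll β.2 (fun i => v (i + 1)) (P.f (x, u ⟨0, P.N_pos⟩, β.2)) P.N
      = P.f (z, κ z β, β.2) := by
    rw [← hv0, ← P.roll_succ', roll, hzr, hvN]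
  have hd := hdec β hβ z hzT
  refine ⟨fun i => v (i + 1), fun k => hvU _, ?_, z, hzT, κ z β, ha, ?_⟩
  · have h1 : P.VN x u β = P.VN x (fun i => v i) β := by rw [hvu]
    rw [h1, P.VN_eq_roll (fun i => v (i + 1)), P.VN_eq_roll v, hend, hzr, ← hv0]
    simp only [← P.roll_succ']
    -- The sum of N + 1 stage costs is split at its first and at its last term; the common part
    -- cancels.
    have h2 := Finset.sum_range_succ' (fun k => P.l (P.roll β.2 v x k) (v k) β) P.N
    rw [Finset.sum_range_succ, hzr, hvN] at h2
    have h3 : P.roll β.2 v x 0 = x := rfl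
    rw [h3] at h2
    linarith
  · rw [P.traj_eq_roll β.2 (fun i => v (i + 1)) _ le_rfl, hend]
    linarith

/-! ### The optimal cost -/

lemma VN0_le {x : Vec n} {β : Param nr nu ny nd} {u : Fin P.N → Vec nu}
    (hu : u ∈ P.feasInputs x β) : P.VN0 x β ≤ (P.VN x u β : ℝ) :=
  iInf₂_le u hu

/-- The infimum is attained, hence finite, so estimates can be made on real costs. -/
lemma VN0_eq {u0 : Vec n → Param nr nu ny nd → Fin P.N → Vec nu} (hu0 : P.IsRegulatorSelection u0)
    {ξ : Vec n × Param nr nu ny nd} (hξ : ξ ∈ P.feasPairs) :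
    P.VN0 ξ.1 ξ.2 = (P.VN ξ.1 (u0 ξ.1 ξ.2) ξ.2 : ℝ) :=
  le_antisymm (VN0_le (hu0 ξ hξ).1)
    (le_iInf₂ fun u hu => EReal.coe_le_coe_iff.2 ((hu0 ξ hξ).2 u hu))

/-- The domain of stability consists of the pairs with a feasible input sequence of cost at most
`ρ`. -/
lemma mem_domain_iff {u0 : Vec n → Param nr nu ny nd → Fin P.N → Vec nu}
    (hu0 : P.IsRegulatorSelection u0) {Bc : Set (Param nr nu ny nd)} {δ₀ ρ : ℝ}
    (hB : P.Bhat Bc δ₀ ⊆ P.paramSet) {ξ : Vec n × Param nr nu ny nd} :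
    ξ ∈ P.domain Bc δ₀ ρ ↔ ξ.1 ∈ P.X ∧ ξ.2 ∈ P.Bhat Bc δ₀ ∧
      ∃ u ∈ P.feasInputs ξ.1 ξ.2, P.VN ξ.1 u ξ.2 ≤ ρ := by
  constructor
  · rintro ⟨hξ, hV, hb⟩
    rw [VN0_eq hu0 hξ, EReal.coe_le_coe_iff] at hV
    exact ⟨hξ.1, hb, _, (hu0 ξ hξ).1, hV⟩
  · rintro ⟨hx, hb, u, hu, hV⟩
    exact ⟨⟨hx, hB hb, u, hu⟩, (VN0_le hu).trans (EReal.coe_le_coe_iff.2 hV), hb⟩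

end MPC

/-! ### Components of the lumped perturbation -/

namespace Pert

variable {n nu ny nd nr : ℕ} (p : Pert n nu ny nd nr)

lemma norm_nonneg : 0 ≤ ‖p‖ := Real.sqrt_nonneg _

lemma component_norm_le : ‖p.ex‖ ≤ ‖p‖ ∧ ‖p.ed‖ ≤ ‖p‖ ∧ ‖p.exNext‖ ≤ ‖p‖ ∧ ‖p.edNext‖ ≤ ‖p‖ ∧
    ‖p.ds‖ ≤ ‖p‖ ∧ ‖p.w‖ ≤ ‖p‖ ∧ ‖p.wd‖ ≤ ‖p‖ ∧ ‖p.v‖ ≤ ‖p‖ := by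
  have h1 := sq_nonneg ‖p.ex‖
  have h2 := sq_nonneg ‖p.ed‖
  have h3 := sq_nonneg ‖p.exNext‖
  have h4 := sq_nonneg ‖p.edNext‖
  have h5 := sq_nonneg ‖p.ds.1‖
  have h6 := sq_nonneg ‖p.ds.2.1‖
  have h7 := sq_nonneg ‖p.ds.2.2‖
  have h8 := sq_nonneg ‖p.w‖
  have h9 := sq_nonneg ‖p.wd‖
  have h10 := sq_nonneg ‖p.v‖
  rw [Prod.norm_def, Prod.norm_def, sup_le_iff, sup_le_iff]
  refine ⟨?_, ?_, ?_, ?_, ⟨?_, ?_, ?_⟩, ?_, ?_, ?_⟩ <;>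
    exact Real.le_sqrt_of_sq_le (by linarith)

end Pert

/-! ### Compactness, continuity and cost bounds -/

namespace MPC

variable {n nu ny nd nr nc : ℕ}

/-- The standing assumptions: continuity, constraints, costs, terminal ingredients and continuity
of the targets, together with the selections of targets and of optimal inputs. -/
structure Standing (P : MPC n nu ny nd nr nc) (zs : Param nr nu ny nd → Vec n × Vec nu)
    (u0 : Vec n → Param nr nu ny nd → Fin P.N → Vec nu)
    (Q : Matrix (Fin n) (Fin n) ℝ) (R : Matrix (Fin nu) (Fin nu) ℝ)
    (Pf : Param nr nu ny nd → Matrix (Fin n) (Fin n) ℝ) (w : Fin nc → ℝ)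
    (Bc : Set (Param nr nu ny nd)) (δ₀ : ℝ) : Prop where
  target : P.IsTargetSelection zs
  regulator : P.IsRegulatorSelection u0
  cont : P.ContinuityAssumption
  cons : P.ConstraintAssumption
  terminal : P.TerminalLaw
  quad : P.QuadraticCosts zs Q R Pf w
  sstp : P.TargetContinuity zs Bc δ₀
  Pf_cont : ContinuousOn Pf (P.Bhat Bc δ₀)

namespace Standing

variable {P : MPC n nu ny nd nr nc} {zs : Param nr nu ny nd → Vec n × Vec nu}
  {u0 : Vec n → Param nr nu ny nd → Fin P.N → Vec nu}
  {Q : Matrix (Fin n) (Fin n) ℝ} {R : Matrix (Fin nu) (Fin nu) ℝ}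
  {Pf : Param nr nu ny nd → Matrix (Fin n) (Fin n) ℝ} {w : Fin nc → ℝ}
  {Bc : Set (Param nr nu ny nd)} {δ₀ ρ : ℝ} (H : P.Standing zs u0 Q R Pf w Bc δ₀)

include H

/-- This is the image of a closed part of ℬ_c × ball under (s, d, e) ↦ (s, d - e). -/
lemma isCompact_Bhat : IsCompact (P.Bhat Bc δ₀) := by
  have h1 : IsCompact (Bc ×ˢ Metric.closedBall (0 : Vec nd) δ₀) :=
    H.sstp.Bc_compact.prod (isCompact_closedBall 0 δ₀)
  have hc : Continuous fun q : Param nr nu ny nd × Vec nd => q.1.2 - q.2 := by fun_prop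
  have h2 : IsClosed ((fun q : Param nr nu ny nd × Vec nd => q.1.2 - q.2) ⁻¹' P.D) :=
    H.cons.D_compact.isClosed.preimage hc
  have h3 := (h1.inter_right h2).image
    (show Continuous fun q : Param nr nu ny nd × Vec nd => ((q.1.1, q.1.2 - q.2) : Param nr nu ny nd)
      by fun_prop)
  convert h3 using 1
  ext ⟨s, d⟩
  constructor
  · rintro ⟨d', ed, hB, he, hd, hD⟩
    simp only at hd hB hD
    refine ⟨((s, d'), ed), ⟨⟨hB, by simpa using he⟩, ?_⟩, by simp [hd]⟩
    simpa [← hd] using hD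
  · rintro ⟨⟨⟨s', d'⟩, ed⟩, ⟨⟨hB, he⟩, hD⟩, heq⟩
    simp only [Prod.mk.injEq] at heq
    obtain ⟨rfl, rfl⟩ := heq
    exact ⟨d', ed, hB, by simpa using he, rfl, hD⟩

lemma mem_D {β : Param nr nu ny nd} (hβ : β ∈ P.Bhat Bc δ₀) : β.2 ∈ P.D :=
  (H.sstp.Bhat_subset hβ).2.1

lemma continuousOn_Vf : ContinuousOn (fun z : Vec n × Param nr nu ny nd => P.Vf z.1 z.2)
    (P.X ×ˢ P.Bhat Bc δ₀) := by
  refine ContinuousOn.congr (f := fun z => wsq (Pf z.2) (z.1 - (zs z.2).1)) ?_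
    fun z hz => H.quad.terminal z.1 hz.1 z.2 (H.sstp.Bhat_subset hz.2)
  have h2 : MapsTo (Prod.snd : Vec n × Param nr nu ny nd → _) (P.X ×ˢ P.Bhat Bc δ₀)
    (P.Bhat Bc δ₀) := fun z hz => hz.2
  exact continuous_wsq.comp_continuousOn ((H.Pf_cont.comp continuousOn_snd h2).prodMk
    (continuousOn_fst.sub (H.sstp.zs_cont.comp continuousOn_snd h2).fst))

lemma continuousOn_l : ContinuousOn
    (fun z : Vec n × Vec nu × Param nr nu ny nd => P.l z.1 z.2.1 z.2.2)
    (P.X ×ˢ P.U ×ˢ P.Bhat Bc δ₀) := by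
  refine ContinuousOn.congr (f := fun z => wsq Q (z.1 - (zs z.2.2).1) +
    wsq R (z.2.1 - (zs z.2.2).2) +
    ∑ i, w i * max 0 (P.cbar (z.2.1, P.h (z.1, z.2.1, z.2.2.2)) i)) ?_
    fun z hz => H.quad.stage z.1 hz.1 z.2.1 hz.2.1 z.2.2 (H.sstp.Bhat_subset hz.2.2)
  have hs : ContinuousOn (fun z : Vec n × Vec nu × Param nr nu ny nd => zs z.2.2)
      (P.X ×ˢ P.U ×ˢ P.Bhat Bc δ₀) :=
    H.sstp.zs_cont.comp (by fun_prop) fun z hz => hz.2.2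
  have hm : MapsTo (fun z : Vec n × Vec nu × Param nr nu ny nd => (z.1, z.2.1, z.2.2.2))
      (P.X ×ˢ P.U ×ˢ P.Bhat Bc δ₀) (P.X ×ˢ P.U ×ˢ P.D) :=
    fun z hz => ⟨hz.1, hz.2.1, H.mem_D hz.2.2⟩
  have hh : ContinuousOn
      (fun z : Vec n × Vec nu × Param nr nu ny nd => P.h (z.1, z.2.1, z.2.2.2))
      (P.X ×ˢ P.U ×ˢ P.Bhat Bc δ₀) := H.cont.h_cont.comp (by fun_prop) hm
  have hu : ContinuousOn (fun z : Vec n × Vec nu × Param nr nu ny nd => z.2.1)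
    (P.X ×ˢ P.U ×ˢ P.Bhat Bc δ₀) := by fun_prop
  have hc : ContinuousOn (fun z : Vec n × Vec nu × Param nr nu ny nd =>
      P.cbar (z.2.1, P.h (z.1, z.2.1, z.2.2.2))) (P.X ×ˢ P.U ×ˢ P.Bhat Bc δ₀) :=
    H.cons.cbar_cont.comp (hu.prodMk hh) fun z hz => ⟨hz.2.1, H.cont.h_maps (hm hz)⟩
  refine ((continuous_wsq.comp_continuousOn (continuousOn_const.prodMk
    (continuousOn_fst.sub hs.fst))).add (continuous_wsq.comp_continuousOn
      (continuousOn_const.prodMk (hu.sub hs.snd)))).add (continuousOn_finsetSum _ fun i _ => ?_)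
  exact continuousOn_const.mul (continuousOn_const.sup (continuousOn_pi.1 hc i))

omit H in
lemma continuousOn_traj (hf : ContinuousOn P.f (P.X ×ˢ P.U ×ˢ P.D))
    (hm : MapsTo P.f (P.X ×ˢ P.U ×ˢ P.D) P.X) (k : ℕ) : ContinuousOn
    (fun z : Vec n × (Fin P.N → Vec nu) × Vec nd => P.traj z.1 z.2.1 z.2.2 k)
    (P.X ×ˢ Set.pi univ (fun _ => P.U) ×ˢ P.D) := by
  induction k with
  | zero => exact continuousOn_fst
  | succ k ih =>
    simp only [traj]
    split_ifs with hk
    · have hu : Continuous fun z : Vec n × (Fin P.N → Vec nu) × Vec nd =>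
          (z.2.1 ⟨k, hk⟩, z.2.2) := by fun_prop
      refine hf.comp (ih.prodMk hu.continuousOn) fun z hz => ⟨?_, hz.2.1 _ trivial, hz.2.2⟩
      exact traj_mem hm hz.2.2 (fun k => hz.2.1 k trivial) hz.1 k
    · exact ih

lemma continuousOn_traj_param (k : ℕ) : ContinuousOn
    (fun z : Vec n × (Fin P.N → Vec nu) × Param nr nu ny nd => P.traj z.1 z.2.1 z.2.2.2 k)
    (P.X ×ˢ Set.pi univ (fun _ => P.U) ×ˢ P.Bhat Bc δ₀) :=
  (continuousOn_traj H.cont.f_cont H.cont.f_maps k).comp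
    (f := fun z : Vec n × (Fin P.N → Vec nu) × Param nr nu ny nd => (z.1, z.2.1, z.2.2.2))
    (by fun_prop) fun _ hz => ⟨hz.1, hz.2.1, H.mem_D hz.2.2⟩

lemma traj_mem_X {z : Vec n × (Fin P.N → Vec nu) × Param nr nu ny nd}
    (hz : z ∈ P.X ×ˢ Set.pi univ (fun _ => P.U) ×ˢ P.Bhat Bc δ₀) (k : ℕ) :
    P.traj z.1 z.2.1 z.2.2.2 k ∈ P.X :=
  traj_mem H.cont.f_maps (H.mem_D hz.2.2) (fun k => hz.2.1 k trivial) hz.1 k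

lemma continuousOn_Vf_traj : ContinuousOn
    (fun z : Vec n × (Fin P.N → Vec nu) × Param nr nu ny nd =>
      P.Vf (P.traj z.1 z.2.1 z.2.2.2 P.N) z.2.2)
    (P.X ×ˢ Set.pi univ (fun _ => P.U) ×ˢ P.Bhat Bc δ₀) :=
  H.continuousOn_Vf.comp ((H.continuousOn_traj_param P.N).prodMk (by fun_prop))
    fun _ hz => ⟨H.traj_mem_X hz _, hz.2.2⟩

lemma continuousOn_VN : ContinuousOn
    (fun z : Vec n × (Fin P.N → Vec nu) × Param nr nu ny nd => P.VN z.1 z.2.1 z.2.2)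
    (P.X ×ˢ Set.pi univ (fun _ => P.U) ×ˢ P.Bhat Bc δ₀) := by
  unfold VN
  refine H.continuousOn_Vf_traj.add (continuousOn_finsetSum _ fun k _ => ?_)
  have hu : Continuous fun z : Vec n × (Fin P.N → Vec nu) × Param nr nu ny nd =>
    (z.2.1 k, z.2.2) := by fun_prop
  exact H.continuousOn_l.comp ((H.continuousOn_traj_param k).prodMk hu.continuousOn)
    fun z hz => ⟨H.traj_mem_X hz _, hz.2.1 k trivial, hz.2.2⟩

/-- The stage cost is bounded below by the squared tracking errors. -/
lemma exists_stage_lower_bound : ∃ q : ℝ, 0 < q ∧ ∀ x ∈ P.X, ∀ u ∈ P.U, ∀ β ∈ P.paramSet,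
    q * ‖x - (zs β).1‖ ^ 2 + q * ‖u - (zs β).2‖ ^ 2 ≤ P.l x u β := by
  -- A constant weight is a continuous family over a one-point space.
  obtain ⟨p, _, hp, _, hQ⟩ := exists_wsq_bounds (isCompact_singleton (x := ()))
    (M := fun _ => Q) continuousOn_const fun _ _ => H.quad.Q_pos
  obtain ⟨q, _, hq, _, hR⟩ := exists_wsq_bounds (isCompact_singleton (x := ()))
    (M := fun _ => R) continuousOn_const fun _ _ => H.quad.R_pos
  refine ⟨min p q, lt_min hp hq, fun x hx u hu β hβ => ?_⟩
  rw [H.quad.stage x hx u hu β hβ]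
  have h1 := (hQ () rfl (x - (zs β).1)).1
  have h2 := (hR () rfl (u - (zs β).2)).1
  have h3 : 0 ≤ ∑ i, w i * max 0 (P.cbar (u, P.h (x, u, β.2)) i) :=
    Finset.sum_nonneg fun i _ => mul_nonneg (H.quad.w_pos i).le (le_max_left _ _)
  have h4 : min p q * ‖x - (zs β).1‖ ^ 2 ≤ p * ‖x - (zs β).1‖ ^ 2 := by gcongr; exact min_le_left _ _
  have h5 : min p q * ‖u - (zs β).2‖ ^ 2 ≤ q * ‖u - (zs β).2‖ ^ 2 := by gcongr; exact min_le_right _ _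
  linarith

lemma stage_nonneg {x : Vec n} (hx : x ∈ P.X) {u : Vec nu} (hu : u ∈ P.U)
    {β : Param nr nu ny nd} (hβ : β ∈ P.paramSet) : 0 ≤ P.l x u β := by
  obtain ⟨q, hq, h⟩ := H.exists_stage_lower_bound
  exact (by positivity : 0 ≤ q * ‖x - (zs β).1‖ ^ 2 + q * ‖u - (zs β).2‖ ^ 2).trans (h x hx u hu β hβ)

lemma exists_terminal_bounds : ∃ q : ℝ, 0 < q ∧ ∀ x ∈ P.X, ∀ β ∈ P.Bhat Bc δ₀,
    0 ≤ P.Vf x β ∧ P.Vf x β ≤ q * ‖x - (zs β).1‖ ^ 2 := by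
  obtain ⟨p, q, hp, hq, hb⟩ := exists_wsq_bounds H.isCompact_Bhat H.Pf_cont
    fun β hβ => H.quad.Pf_pos β (H.sstp.Bhat_subset hβ)
  refine ⟨q, hq, fun x hx β hβ => ?_⟩
  rw [H.quad.terminal x hx β (H.sstp.Bhat_subset hβ)]
  exact ⟨le_trans (by positivity) (hb β hβ _).1, (hb β hβ _).2⟩

lemma stage_zero_le_VN {x : Vec n} (hx : x ∈ P.X) {β : Param nr nu ny nd} (hβ : β ∈ P.Bhat Bc δ₀)
    {u : Fin P.N → Vec nu} (hu : ∀ k, u k ∈ P.U) : P.l x (u ⟨0, P.N_pos⟩) β ≤ P.VN x u β := by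
  obtain ⟨q, -, hV⟩ := H.exists_terminal_bounds
  have hz : ∀ k, P.traj x u β.2 k ∈ P.X := traj_mem H.cont.f_maps (H.mem_D hβ) hu hx
  have h1 := (hV _ (hz P.N) β hβ).1
  have h2 := Finset.single_le_sum (f := fun k : Fin P.N => P.l (P.traj x u β.2 k) (u k) β)
    (fun k _ => H.stage_nonneg (hz k) (hu k) (H.sstp.Bhat_subset hβ))
    (Finset.mem_univ ⟨0, P.N_pos⟩)
  unfold VN
  have h3 : P.traj x u β.2 0 = x := rfl
  simp only [h3] at h2
  linarith

/-- Lower and upper quadratic bounds of the optimal cost on the domain. -/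
lemma exists_cost_bounds (hρ : 0 < ρ) : ∃ a₁ a₂ : ℝ, 0 < a₁ ∧ 0 < a₂ ∧
    (∀ ξ ∈ P.domain Bc δ₀ ρ, P.VN ξ.1 (u0 ξ.1 ξ.2) ξ.2 ≤ a₂ * ‖ξ.1 - (zs ξ.2).1‖ ^ 2) ∧
    (∀ x ∈ P.X, ∀ u ∈ P.U, ∀ β ∈ P.paramSet,
      a₁ * ‖x - (zs β).1‖ ^ 2 + a₁ * ‖u - (zs β).2‖ ^ 2 ≤ P.l x u β) := by
  obtain ⟨a, ha, hl⟩ := H.exists_stage_lower_bound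
  obtain ⟨q, hq, hV⟩ := H.exists_terminal_bounds
  have hcf := P.cf_pos
  -- If q|δx̂|² ≤ c_f, the state is in the terminal set and the terminal law gives the bound with q.
  -- Otherwise q|δx̂|²/c_f > 1, so ρ ≤ (ρq/c_f)|δx̂|².
  refine ⟨a, max q (ρ * q / P.cf), ha, lt_max_of_lt_left hq, fun ξ hξ => ?_, hl⟩
  have hx := hξ.1.1
  have hV1 := (hV ξ.1 hx ξ.2 hξ.2.2).2
  rcases le_or_gt (q * ‖ξ.1 - (zs ξ.2).1‖ ^ 2) P.cf with h | h
  · obtain ⟨u, hu, hle⟩ := exists_feasInputs_of_mem_termSet H.cont.f_maps H.terminal hξ.1.2.1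
      (fun x hx u hu => H.stage_nonneg hx hu hξ.1.2.1) (⟨hx, hV1.trans h⟩ : ξ.1 ∈ P.termSet ξ.2)
    refine (((H.regulator ξ hξ.1).2 u hu).trans (hle.trans hV1)).trans ?_
    gcongr
    exact le_max_left _ _
  · have h1 := hξ.2.1
    rw [VN0_eq H.regulator hξ.1, EReal.coe_le_coe_iff] at h1
    refine h1.trans (le_trans ?_ (mul_le_mul_of_nonneg_right (le_max_right _ _) (sq_nonneg _)))
    rw [mul_div_assoc, mul_assoc, div_mul_eq_mul_div]
    exact le_mul_of_one_le_right hρ.le ((one_le_div hcf).2 h.le)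

lemma kappa_mem {ξ : Vec n × Param nr nu ny nd} (hξ : ξ ∈ P.domain Bc δ₀ ρ) :
    P.kappa u0 ξ.1 ξ.2 ∈ P.U :=
  (H.regulator ξ hξ.1).1.1 _

/-- The targets, and the states in the domain, lie in a ball. -/
lemma exists_radius : ∃ r : ℝ, 0 ≤ r ∧ (∀ β ∈ P.Bhat Bc δ₀, ‖zs β‖ ≤ r) ∧
    ∀ ξ ∈ P.domain Bc δ₀ ρ, ‖ξ.1‖ ≤ r := by
  obtain ⟨q, hq, hl⟩ := H.exists_stage_lower_bound
  obtain ⟨s, hs⟩ := (H.isCompact_Bhat.image_of_continuousOn H.sstp.zs_cont).isBounded.exists_norm_le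
  have hs' : ∀ β ∈ P.Bhat Bc δ₀, ‖zs β‖ ≤ s := fun β hβ => hs _ (mem_image_of_mem _ hβ)
  -- The targets are bounded by compactness; the tracking error is at most √(ρ/q), since the first
  -- stage cost is at most ρ.
  refine ⟨|s| + √(ρ / q), by positivity, fun β hβ => ?_, fun ξ hξ => ?_⟩
  · have h1 := hs' β hβ
    have h2 := le_abs_self s
    have h3 := Real.sqrt_nonneg (ρ / q)
    linarith
  · have hu := (H.regulator ξ hξ.1).1
    have h1 := hl _ hξ.1.1 _ (hu.1 ⟨0, P.N_pos⟩) _ hξ.1.2.1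
    have h2 := H.stage_zero_le_VN hξ.1.1 hξ.2.2 hu.1
    have h3 := hξ.2.1
    rw [VN0_eq H.regulator hξ.1, EReal.coe_le_coe_iff] at h3
    have h4 : 0 ≤ q * ‖u0 ξ.1 ξ.2 ⟨0, P.N_pos⟩ - (zs ξ.2).2‖ ^ 2 := by positivity
    have h5 : ‖ξ.1 - (zs ξ.2).1‖ ≤ √(ρ / q) := by
      refine Real.le_sqrt_of_sq_le ?_
      rw [le_div_iff₀ hq]
      linarith
    have h6 := norm_le_norm_sub_add ξ.1 (zs ξ.2).1
    have h7 := (norm_fst_le (zs ξ.2)).trans (hs' _ hξ.2.2)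
    have h8 := le_abs_self s
    linarith

lemma isCompact_states (r : ℝ) : IsCompact (P.X ∩ Metric.closedBall 0 r) :=
  (isCompact_closedBall 0 r).inter_left H.cons.X_closed

/-- Continuity of the optimal cost is not needed: the domain is the projection along the inputs of a
compact set of triples (x, u, β). -/
lemma isClosed_domain : IsClosed (P.domain Bc δ₀ ρ) := by
  obtain ⟨r, -, -, hr⟩ := H.exists_radius (ρ := ρ)
  set K : Set (Vec n × (Fin P.N → Vec nu) × Param nr nu ny nd) :=
    (P.X ∩ Metric.closedBall 0 r) ×ˢ Set.pi univ (fun _ => P.U) ×ˢ P.Bhat Bc δ₀ with hK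
  have hKc : IsCompact K := (H.isCompact_states r).prod
    ((isCompact_univ_pi fun _ => H.cons.U_compact).prod H.isCompact_Bhat)
  have hsub : K ⊆ P.X ×ˢ Set.pi univ (fun _ => P.U) ×ˢ P.Bhat Bc δ₀ := fun z hz => ⟨hz.1.1, hz.2⟩
  have h1 := (H.continuousOn_Vf_traj.mono hsub).preimage_isClosed_of_isClosed hKc.isClosed
    (isClosed_Iic (a := P.cf))
  have h2 := (H.continuousOn_VN.mono hsub).preimage_isClosed_of_isClosed hKc.isClosed
    (isClosed_Iic (a := ρ))
  have h3 := (hKc.of_isClosed_subset (h1.inter h2) fun z hz => hz.1.1).image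
    (show Continuous fun z : Vec n × (Fin P.N → Vec nu) × Param nr nu ny nd => (z.1, z.2.2) by
      fun_prop)
  convert h3.isClosed using 1
  ext ξ
  constructor
  · intro hξ
    obtain ⟨hx, hβ, u, hu, hV⟩ := (mem_domain_iff H.regulator H.sstp.Bhat_subset).1 hξ
    have hz : (ξ.1, u, ξ.2) ∈ K := ⟨⟨hx, by simpa using hr ξ hξ⟩, fun k _ => hu.1 k, hβ⟩
    exact ⟨(ξ.1, u, ξ.2), ⟨⟨hz, hu.2.2⟩, hz, hV⟩, rfl⟩
  · rintro ⟨⟨x, u, β⟩, ⟨⟨hz, hT⟩, -, hV⟩, rfl⟩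
    exact (mem_domain_iff H.regulator H.sstp.Bhat_subset).2
      ⟨hz.1.1, hz.2.2, u, ⟨fun k => hz.2.1 k trivial, H.traj_mem_X (hsub hz) _, hT⟩, hV⟩

end Standing

end MPC

/-! ### Robust descent and setpoint tracking -/

namespace MPC

variable {n nu ny nd nr nc : ℕ}

lemma dist_paramNext_le (β : Param nr nu ny nd) (p : Pert n nu ny nd nr) :
    dist (paramNext β p) β ≤ 3 * ‖p‖ := by
  obtain ⟨-, h2, -, h4, h5, -, h7, -⟩ := p.component_norm_le
  have hp := p.norm_nonneg
  refine max_le ?_ ?_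
  · simp only [paramNext, dist_self_add_left]
    linarith
  · simp only [paramNext, dist_eq_norm]
    have h : β.2 + p.ed + p.wd - p.edNext - β.2 = p.ed + p.wd - p.edNext := by abel
    rw [h]
    have h8 := norm_sub_le (p.ed + p.wd) p.edNext
    have h9 := norm_add_le p.ed p.wd
    linarith

namespace Standing

variable {P : MPC n nu ny nd nr nc} {zs : Param nr nu ny nd → Vec n × Vec nu}
  {u0 : Vec n → Param nr nu ny nd → Fin P.N → Vec nu}
  {Q : Matrix (Fin n) (Fin n) ℝ} {R : Matrix (Fin nu) (Fin nu) ℝ}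
  {Pf : Param nr nu ny nd → Matrix (Fin n) (Fin n) ℝ} {w : Fin nc → ℝ}
  {Bc : Set (Param nr nu ny nd)} {δ₀ ρ : ℝ} (H : P.Standing zs u0 Q R Pf w Bc δ₀)

include H

/-- Distance of the perturbed successor from the nominal one, both in a fixed ball. -/
lemma exists_stateNext_modulus : ∃ (σ : ℝ → ℝ) (r : ℝ), IsClassKInf σ ∧
    ∀ ξ ∈ P.domain Bc δ₀ ρ, ∀ p ∈ P.closedLoopPert u0 Bc δ₀ 1 ξ,
      ‖P.f (ξ.1, P.kappa u0 ξ.1 ξ.2, ξ.2.2)‖ ≤ r ∧ ‖P.stateNext u0 ξ.1 ξ.2 p‖ ≤ r ∧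
      dist (P.stateNext u0 ξ.1 ξ.2 p) (P.f (ξ.1, P.kappa u0 ξ.1 ξ.2, ξ.2.2)) ≤ σ ‖p‖ := by
  obtain ⟨r, -, -, hr⟩ := H.exists_radius (ρ := ρ)
  have hA : IsCompact ((P.X ∩ Metric.closedBall 0 (r + 1)) ×ˢ P.U ×ˢ P.D) :=
    (H.isCompact_states _).prod (H.cons.U_compact.prod H.cons.D_compact)
  have hfA : ContinuousOn P.f ((P.X ∩ Metric.closedBall 0 (r + 1)) ×ˢ P.U ×ˢ P.D) :=
    H.cont.f_cont.mono fun z hz => ⟨hz.1.1, hz.2⟩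
  obtain ⟨σ, hσ, hle⟩ := exists_modulus hA hfA
  obtain ⟨s, hs⟩ := (hA.image_of_continuousOn hfA).isBounded.exists_norm_le
  -- Twice `‖p‖` accounts for w and e_x⁺, which enter additively.
  refine ⟨fun t => σ t + 2 * t, s + 2, hσ.add (.linear two_pos), fun ξ hξ p hp => ?_⟩
  obtain ⟨h1, h2, h3, -, -, h6, -, -⟩ := p.component_norm_le
  have hp1 : ‖p‖ ≤ 1 := hp.2.2
  have hx := hr ξ hξ
  have hu := H.kappa_mem hξ
  have hm : (ξ.1, P.kappa u0 ξ.1 ξ.2, ξ.2.2) ∈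
      (P.X ∩ Metric.closedBall 0 (r + 1)) ×ˢ P.U ×ˢ P.D :=
    ⟨⟨hξ.1.1, by simpa using hx.trans (by linarith)⟩, hu, H.mem_D hξ.2.2⟩
  have hm' : (ξ.1 + p.ex, P.kappa u0 ξ.1 ξ.2, ξ.2.2 + p.ed) ∈
      (P.X ∩ Metric.closedBall 0 (r + 1)) ×ˢ P.U ×ˢ P.D :=
    ⟨⟨hp.1.1, by simpa using (norm_add_le _ _).trans (by linarith)⟩, hu, hp.1.2.1⟩
  have hd : dist (ξ.1 + p.ex, P.kappa u0 ξ.1 ξ.2, ξ.2.2 + p.ed)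
      (ξ.1, P.kappa u0 ξ.1 ξ.2, ξ.2.2) ≤ ‖p‖ := by
    simp only [Prod.dist_eq, dist_self_add_left, dist_self]
    exact max_le h1 (max_le p.norm_nonneg h2)
  have hf1 := hs _ (mem_image_of_mem _ hm)
  have hf2 := hs _ (mem_image_of_mem _ hm')
  have hf3 := (hle _ hm' _ hm).trans (hσ.1.mono dist_nonneg hd)
  rw [dist_eq_norm] at hf3 ⊢
  unfold stateNext
  refine ⟨by linarith, ?_, ?_⟩
  · have h8 := norm_sub_le (P.f (ξ.1 + p.ex, P.kappa u0 ξ.1 ξ.2, ξ.2.2 + p.ed) + p.w) p.exNext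
    have h9 := norm_add_le (P.f (ξ.1 + p.ex, P.kappa u0 ξ.1 ξ.2, ξ.2.2 + p.ed)) p.w
    linarith
  · generalize P.f (ξ.1 + p.ex, P.kappa u0 ξ.1 ξ.2, ξ.2.2 + p.ed) = y at *
    generalize P.f (ξ.1, P.kappa u0 ξ.1 ξ.2, ξ.2.2) = y' at *
    have h : y + p.w - p.exNext - y' = (y - y') + p.w - p.exNext := by abel
    rw [h]
    have h8 := norm_sub_le (y - y' + p.w) p.exNext
    have h9 := norm_add_le (y - y') p.w
    linarith

/-- Continuity of the cost and of the terminal cost with respect to the perturbation, uniformly in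
the input sequence. -/
lemma exists_cost_modulus : ∃ σ : ℝ → ℝ, IsClassKInf σ ∧
    ∀ ξ ∈ P.domain Bc δ₀ ρ, ∀ p ∈ P.closedLoopPert u0 Bc δ₀ 1 ξ,
      ∀ v : Fin P.N → Vec nu, (∀ k, v k ∈ P.U) →
      P.VN (P.closedLoop u0 ξ p).1 v (P.closedLoop u0 ξ p).2 ≤
        P.VN (P.f (ξ.1, P.kappa u0 ξ.1 ξ.2, ξ.2.2)) v ξ.2 + σ ‖p‖ ∧
      P.Vf (P.traj (P.closedLoop u0 ξ p).1 v (P.closedLoop u0 ξ p).2.2 P.N)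
          (P.closedLoop u0 ξ p).2 ≤
        P.Vf (P.traj (P.f (ξ.1, P.kappa u0 ξ.1 ξ.2, ξ.2.2)) v ξ.2.2 P.N) ξ.2 + σ ‖p‖ := by
  obtain ⟨τ, r, hτ, hnext⟩ := H.exists_stateNext_modulus (ρ := ρ)
  have hK : IsCompact ((P.X ∩ Metric.closedBall 0 r) ×ˢ
      Set.pi univ (fun _ : Fin P.N => P.U) ×ˢ P.Bhat Bc δ₀) := (H.isCompact_states r).prod
    ((isCompact_univ_pi fun _ => H.cons.U_compact).prod H.isCompact_Bhat)
  -- One modulus serves the pair of costs. The input sequence is a coordinate of the compact set and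
  -- equal at both points compared, hence the uniformity in it.
  obtain ⟨σ, hσ, hle⟩ := exists_modulus hK
    ((H.continuousOn_VN.prodMk H.continuousOn_Vf_traj).mono fun z hz => ⟨hz.1.1, hz.2⟩)
  refine ⟨fun t => σ (τ t + 3 * t), hσ.comp (hτ.add (.linear three_pos)), fun ξ hξ p hp v hv => ?_⟩
  obtain ⟨h1, h2, h3⟩ := hnext ξ hξ p hp
  have hp0 := p.norm_nonneg
  have hm : (P.f (ξ.1, P.kappa u0 ξ.1 ξ.2, ξ.2.2), v, ξ.2) ∈ (P.X ∩ Metric.closedBall 0 r) ×ˢ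
      Set.pi univ (fun _ : Fin P.N => P.U) ×ˢ P.Bhat Bc δ₀ :=
    ⟨⟨H.cont.f_maps ⟨hξ.1.1, H.kappa_mem hξ, H.mem_D hξ.2.2⟩, by simpa using h1⟩,
      fun k _ => hv k, hξ.2.2⟩
  have hm' : ((P.closedLoop u0 ξ p).1, v, (P.closedLoop u0 ξ p).2) ∈
      (P.X ∩ Metric.closedBall 0 r) ×ˢ
      Set.pi univ (fun _ : Fin P.N => P.U) ×ˢ P.Bhat Bc δ₀ :=
    ⟨⟨hp.1.2.2.2.1, mem_closedBall_zero_iff.2 h2⟩, fun k _ => hv k, hp.2.1⟩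
  have hd : dist ((P.closedLoop u0 ξ p).1, v, (P.closedLoop u0 ξ p).2)
      (P.f (ξ.1, P.kappa u0 ξ.1 ξ.2, ξ.2.2), v, ξ.2) ≤ τ ‖p‖ + 3 * ‖p‖ := by
    have h4 := dist_paramNext_le ξ.2 p
    have h5 := hτ.1.nonneg hp0
    refine max_le ?_ (max_le ?_ ?_)
    · exact h3.trans (by linarith)
    · rw [dist_self]; positivity
    · exact h4.trans (by linarith)
  have h6 := (hle _ hm' _ hm).trans (hσ.1.mono dist_nonneg hd)
  rw [Prod.dist_eq, max_le_iff] at h6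
  have h7 := (le_abs_self _).trans (Real.dist_eq _ _ ▸ h6.1)
  have h8 := (le_abs_self _).trans (Real.dist_eq _ _ ▸ h6.2)
  exact ⟨by linarith, by linarith⟩

/-- For small perturbations the domain is positive invariant and the optimal cost is a robust
Lyapunov function on it. -/
lemma exists_robust_descent (hρ : 0 < ρ) : ∃ (δ a₁ a₂ : ℝ) (σ : ℝ → ℝ), 0 < δ ∧ δ ≤ 1 ∧ 0 < a₁ ∧
    a₁ < a₂ ∧ IsClassKInf σ ∧
    (∀ ξ ∈ P.domain Bc δ₀ ρ,
      a₁ * ‖ξ.1 - (zs ξ.2).1‖ ^ 2 + a₁ * ‖P.kappa u0 ξ.1 ξ.2 - (zs ξ.2).2‖ ^ 2 ≤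
        P.VN ξ.1 (u0 ξ.1 ξ.2) ξ.2 ∧
      P.VN ξ.1 (u0 ξ.1 ξ.2) ξ.2 ≤ a₂ * ‖ξ.1 - (zs ξ.2).1‖ ^ 2) ∧
    ∀ ξ ∈ P.domain Bc δ₀ ρ, ∀ p ∈ P.closedLoopPert u0 Bc δ₀ δ ξ,
      P.closedLoop u0 ξ p ∈ P.domain Bc δ₀ ρ ∧
      P.VN (P.closedLoop u0 ξ p).1
          (u0 (P.closedLoop u0 ξ p).1 (P.closedLoop u0 ξ p).2) (P.closedLoop u0 ξ p).2 ≤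
        P.VN ξ.1 (u0 ξ.1 ξ.2) ξ.2 - a₁ * ‖ξ.1 - (zs ξ.2).1‖ ^ 2 + σ ‖p‖ := by
  obtain ⟨a, b, ha, hb, hup, hl⟩ := H.exists_cost_bounds hρ
  obtain ⟨q, hq, hVf⟩ := H.exists_terminal_bounds
  obtain ⟨σ, hσ, hcost⟩ := H.exists_cost_modulus (ρ := ρ)
  have hcf := P.cf_pos
  -- The first two entries are the margins in the terminal constraint; the third is the margin at
  -- level ρ.
  set c := min (min (P.cf / 2) (a * (P.cf / (2 * q)))) (a / (a + b) * ρ) with hc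
  have hc0 : 0 < c := by positivity
  obtain ⟨δ, hδ, hδc⟩ := hσ.1.exists_le hc0
  have hup' : ∀ ξ ∈ P.domain Bc δ₀ ρ,
      P.VN ξ.1 (u0 ξ.1 ξ.2) ξ.2 ≤ (a + b) * ‖ξ.1 - (zs ξ.2).1‖ ^ 2 := by
    intro ξ hξ
    refine (hup ξ hξ).trans ?_
    gcongr
    linarith
  refine ⟨min δ 1, a, a + b, σ, by positivity, min_le_right _ _, ha, by linarith, hσ,
    fun ξ hξ => ⟨?_, hup' ξ hξ⟩, fun ξ hξ p hp => ?_⟩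
  · have hu := (H.regulator ξ hξ.1).1
    exact (hl _ hξ.1.1 _ (H.kappa_mem hξ) _ hξ.1.2.1).trans (H.stage_zero_le_VN hξ.1.1 hξ.2.2 hu.1)
  have hu := (H.regulator ξ hξ.1).1
  have hβ := hξ.1.2.1
  have hpc : σ ‖p‖ ≤ c := hδc _ p.norm_nonneg (hp.2.2.trans (min_le_left _ _))
  have hp1 : p ∈ P.closedLoopPert u0 Bc δ₀ 1 ξ := ⟨hp.1, hp.2.1, hp.2.2.trans (min_le_right _ _)⟩
  obtain ⟨v, hv, hVv, z, hz, α, hα, hzα⟩ := exists_feasInputs_succ H.terminal hβ hu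
  obtain ⟨h1, h2⟩ := hcost ξ hξ p hp1 v hv
  -- Either V_f(z) ≤ c_f/2, or |z - x_s|² ≥ c_f/(2q) and the stage cost at z removes at least
  -- a·c_f/(2q). Both leave room for c.
  have hterm : P.Vf (P.traj (P.closedLoop u0 ξ p).1 v (P.closedLoop u0 ξ p).2.2 P.N)
      (P.closedLoop u0 ξ p).2 ≤ P.cf := by
    refine h2.trans ?_
    have hc1 : c ≤ P.cf / 2 := (min_le_left _ _).trans (min_le_left _ _)
    have hc2 : c ≤ a * (P.cf / (2 * q)) := (min_le_left _ _).trans (min_le_right _ _)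
    have h3 := (hVf z hz.1 ξ.2 hξ.2.2).2
    have h4 := hl z hz.1 α hα ξ.2 hβ
    have h5 : 0 ≤ a * ‖α - (zs ξ.2).2‖ ^ 2 := by positivity
    have h6 : 0 ≤ a * ‖z - (zs ξ.2).1‖ ^ 2 := by positivity
    have h7 : P.Vf z ξ.2 ≤ P.cf := hz.2
    change P.Vf (P.traj (P.f (ξ.1, P.kappa u0 ξ.1 ξ.2, ξ.2.2)) v ξ.2.2 P.N) ξ.2 ≤ _ at hzα
    rcases le_or_gt (P.Vf z ξ.2) (P.cf / 2) with h | h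
    · linarith
    · have h8 : P.cf / (2 * q) ≤ ‖z - (zs ξ.2).1‖ ^ 2 := by
        rw [div_le_iff₀ (by positivity)]
        linarith
      have h9 := mul_le_mul_of_nonneg_left h8 ha.le
      linarith
  have hnext : (P.closedLoop u0 ξ p).1 ∈ P.X := hp.1.2.2.2.1
  have hfeas : v ∈ P.feasInputs (P.closedLoop u0 ξ p).1 (P.closedLoop u0 ξ p).2 :=
    ⟨hv, traj_mem H.cont.f_maps (H.mem_D hp.2.1) hv hnext _, hterm⟩
  have hdec : P.VN (P.closedLoop u0 ξ p).1 v (P.closedLoop u0 ξ p).2 ≤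
      P.VN ξ.1 (u0 ξ.1 ξ.2) ξ.2 - a * ‖ξ.1 - (zs ξ.2).1‖ ^ 2 + σ ‖p‖ := by
    have h3 := hl _ hξ.1.1 _ (hu.1 ⟨0, P.N_pos⟩) _ hβ
    have h4 : 0 ≤ a * ‖u0 ξ.1 ξ.2 ⟨0, P.N_pos⟩ - (zs ξ.2).2‖ ^ 2 := by positivity
    change P.VN (P.f (ξ.1, P.kappa u0 ξ.1 ξ.2, ξ.2.2)) v ξ.2 ≤ _ at hVv
    linarith
  -- The new cost is at most (1 - θ)V + σ with θ = a/(a+b), and σ ≤ θρ.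
  have hmem : P.closedLoop u0 ξ p ∈ P.domain Bc δ₀ ρ := by
    refine (mem_domain_iff H.regulator H.sstp.Bhat_subset).2
      ⟨hnext, hp.2.1, v, hfeas, hdec.trans ?_⟩
    have h3 := hξ.2.1
    rw [VN0_eq H.regulator hξ.1, EReal.coe_le_coe_iff] at h3
    have h4 := hup' ξ hξ
    have hab : 0 < a + b := by linarith
    have hr : 0 < a / (a + b) := by positivity
    have hr1 : a / (a + b) ≤ 1 := (div_le_one hab).2 (by linarith)
    have h5 := mul_le_mul_of_nonneg_left h4 hr.le
    have h6 : a / (a + b) * ((a + b) * ‖ξ.1 - (zs ξ.2).1‖ ^ 2) = a * ‖ξ.1 - (zs ξ.2).1‖ ^ 2 := by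
      field_simp
    have h7 : c ≤ a / (a + b) * ρ := min_le_right _ _
    have h8 := mul_le_mul_of_nonneg_left h3 (sub_nonneg.2 hr1)
    linarith
  exact ⟨hmem, ((H.regulator _ hmem.1).2 v hfeas).trans hdec⟩

/-- Moduli of continuity of `h` and `g` on compact sets bound the setpoint-tracking error in terms
of the target-tracking error and the perturbation. -/
lemma exists_refError_bound {c : ℝ} (hc : 0 < c)
    (hκ : ∀ ξ ∈ P.domain Bc δ₀ ρ,
      ‖P.kappa u0 ξ.1 ξ.2 - (zs ξ.2).2‖ ≤ c * ‖ξ.1 - (zs ξ.2).1‖) :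
    ∃ A ⊆ P.X ×ˢ P.U ×ˢ P.D, ∃ E ⊆ P.U ×ˢ P.Y, IsCompact A ∧ IsCompact E ∧
      ∀ σh σg : ℝ → ℝ, IsClassK σh → IsClassK σg →
        (∀ a ∈ A, ∀ b ∈ A, dist (P.h a) (P.h b) ≤ σh (dist a b)) →
        (∀ a ∈ E, ∀ b ∈ E, dist (P.g a) (P.g b) ≤ σg (dist a b)) →
        ∀ ξ ∈ P.domain Bc δ₀ ρ, ∀ p ∈ P.closedLoopPert u0 Bc δ₀ 1 ξ,
          ‖P.refError u0 ξ p‖ ≤ σg ((c + 1) * (‖targetError zs ξ p‖ + ‖p‖) +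
            σh ((c + 1) * (‖targetError zs ξ p‖ + ‖p‖))) := by
  obtain ⟨r, -, hzr, hr⟩ := H.exists_radius (ρ := ρ)
  have hA : IsCompact ((P.X ∩ Metric.closedBall 0 (r + 1)) ×ˢ P.U ×ˢ P.D) :=
    (H.isCompact_states _).prod (H.cons.U_compact.prod H.cons.D_compact)
  have hAs : (P.X ∩ Metric.closedBall 0 (r + 1)) ×ˢ P.U ×ˢ P.D ⊆ P.X ×ˢ P.U ×ˢ P.D :=
    fun z hz => ⟨hz.1.1, hz.2⟩
  obtain ⟨s, hs⟩ := (hA.image_of_continuousOn (H.cont.h_cont.mono hAs)).isBounded.exists_norm_le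
  -- Since |v| ≤ 1, measured outputs exceed the bound s on h by at most 1.
  refine ⟨_, hAs, P.U ×ˢ (P.Y ∩ Metric.closedBall 0 (s + 1)), fun z hz => ⟨hz.1, hz.2.1⟩, hA,
    H.cons.U_compact.prod ((isCompact_closedBall 0 _).inter_left H.cons.Y_closed),
    fun σh σg hσh hσg hh hg ξ hξ p hp => ?_⟩
  obtain ⟨h1, h2, -, -, -, -, -, h8⟩ := p.component_norm_le
  have hp0 := p.norm_nonneg
  have hp1 : ‖p‖ ≤ 1 := hp.2.2
  have hβ := hξ.1.2.1
  obtain ⟨hxs, hus, -, hys, href⟩ := (H.target ξ.2 hβ).1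
  have hu := H.kappa_mem hξ
  have hm : (ξ.1 + p.ex, P.kappa u0 ξ.1 ξ.2, ξ.2.2 + p.ed) ∈
      (P.X ∩ Metric.closedBall 0 (r + 1)) ×ˢ P.U ×ˢ P.D :=
    ⟨⟨hp.1.1, by simpa using (norm_add_le _ _).trans (add_le_add (hr ξ hξ) (h1.trans hp1))⟩, hu,
      hp.1.2.1⟩
  have hms : ((zs ξ.2).1, (zs ξ.2).2, ξ.2.2) ∈
      (P.X ∩ Metric.closedBall 0 (r + 1)) ×ˢ P.U ×ˢ P.D :=
    ⟨⟨hxs, by simpa using ((norm_fst_le _).trans (hzr _ hξ.2.2)).trans (by linarith)⟩, hus, hβ.2.1⟩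
  set e := ‖targetError zs ξ p‖ with he
  have he0 : 0 ≤ e := norm_nonneg _
  have hκe : ‖P.kappa u0 ξ.1 ξ.2 - (zs ξ.2).2‖ ≤ c * e := hκ ξ hξ
  have hce : 0 ≤ c * e := by positivity
  have hcp : 0 ≤ c * ‖p‖ := by positivity
  have hd : dist (ξ.1 + p.ex, P.kappa u0 ξ.1 ξ.2, ξ.2.2 + p.ed)
      ((zs ξ.2).1, (zs ξ.2).2, ξ.2.2) ≤ (c + 1) * (e + ‖p‖) := by
    refine max_le ?_ (max_le ?_ ?_)
    · have h : ξ.1 + p.ex - (zs ξ.2).1 = (ξ.1 - (zs ξ.2).1) + p.ex := by abel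
      rw [dist_eq_norm]
      simp only
      rw [h]
      have h9 : ‖ξ.1 - (zs ξ.2).1 + p.ex‖ ≤ e + ‖p.ex‖ := norm_add_le _ _
      linarith
    · rw [dist_eq_norm]
      exact hκe.trans (by linarith)
    · simp only [dist_self_add_left]
      linarith
  have hdh := (hh _ hm _ hms).trans (hσh.mono dist_nonneg hd)
  have hy : P.output u0 ξ p ∈ P.Y := hp.1.2.2.1.2.2
  have hE : (P.kappa u0 ξ.1 ξ.2, P.output u0 ξ p) ∈ P.U ×ˢ (P.Y ∩ Metric.closedBall 0 (s + 1)) := by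
    refine ⟨hu, hy, mem_closedBall_zero_iff.2 ((norm_add_le _ _).trans ?_)⟩
    exact add_le_add (hs _ (mem_image_of_mem _ hm)) (h8.trans hp1)
  have hEs : ((zs ξ.2).2, P.h ((zs ξ.2).1, (zs ξ.2).2, ξ.2.2)) ∈
      P.U ×ˢ (P.Y ∩ Metric.closedBall 0 (s + 1)) :=
    ⟨hus, hys.2.1, mem_closedBall_zero_iff.2
      ((hs _ (mem_image_of_mem _ hms)).trans (by linarith))⟩
  have hC : 0 ≤ (c + 1) * (e + ‖p‖) := by positivity
  have hdE : dist (P.kappa u0 ξ.1 ξ.2, P.output u0 ξ p)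
      ((zs ξ.2).2, P.h ((zs ξ.2).1, (zs ξ.2).2, ξ.2.2)) ≤
      (c + 1) * (e + ‖p‖) + σh ((c + 1) * (e + ‖p‖)) := by
    have h9 := hσh.nonneg hC
    refine max_le ?_ ?_
    · rw [dist_eq_norm]
      exact hκe.trans (by linarith)
    · refine (dist_triangle _ (P.h (ξ.1 + p.ex, P.kappa u0 ξ.1 ξ.2, ξ.2.2 + p.ed)) _).trans
        (add_le_add ?_ hdh)
      simp only [output, dist_self_add_left]
      linarith
  have hfin := (hg _ hE _ hEs).trans (hσg.mono dist_nonneg hdE)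
  -- Offset-free targets satisfy r_sp = g(u_s, h(x_s, u_s, d̂)).
  rw [← href, dist_eq_norm] at hfin
  exact hfin

end Standing

end MPC

end OffsetFree

end

/-! ### Assembly of the conclusions -/

theorem mainTheorem2 {n nu ny nd nr nc : ℕ} (P : OffsetFree.MPC n nu ny nd nr nc)
    (zs : OffsetFree.Param nr nu ny nd → OffsetFree.Vec n × OffsetFree.Vec nu)
    (u0 : OffsetFree.Vec n → OffsetFree.Param nr nu ny nd → Fin P.N → OffsetFree.Vec nu)
    (Q : Matrix (Fin n) (Fin n) ℝ) (R : Matrix (Fin nu) (Fin nu) ℝ)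
    (Pf : OffsetFree.Param nr nu ny nd → Matrix (Fin n) (Fin n) ℝ) (w : Fin nc → ℝ)
    (Bc : Set (OffsetFree.Param nr nu ny nd)) (δ₀ : ℝ)
    (hzs : P.IsTargetSelection zs) (hu0 : P.IsRegulatorSelection u0)
    (hcont : P.ContinuityAssumption) (hcons : P.ConstraintAssumption)
    (hexist : P.TargetExistence) (hterm : P.TerminalLaw)
    (hquad : P.QuadraticCosts zs Q R Pf w)
    (hsstp : P.TargetContinuity zs Bc δ₀)
    (hPf : ContinuousOn Pf (P.Bhat Bc δ₀))
    (ρ : ℝ) (hρ : 0 < ρ) :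
    ∃ δ : ℝ, 0 < δ ∧
      -- (a) robust positive invariance
      OffsetFree.IsRPI (P.closedLoop u0) (P.closedLoopPert u0 Bc δ₀ δ) (P.domain Bc δ₀ ρ) ∧
      -- (b) Lyapunov inequalities
      (∃ (a₁ a₂ a₃ : ℝ) (σ : ℝ → ℝ), 0 < a₁ ∧ 0 < a₂ ∧ 0 < a₃ ∧ OffsetFree.IsClassKInf σ ∧
        ∀ ξ ∈ P.domain Bc δ₀ ρ, ∀ p ∈ P.closedLoopPert u0 Bc δ₀ δ ξ,
          ((a₁ * ‖OffsetFree.targetError zs ξ p‖ ^ 2 : ℝ) : EReal) ≤ P.VN0 ξ.1 ξ.2 ∧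
          P.VN0 ξ.1 ξ.2 ≤ ((a₂ * ‖OffsetFree.targetError zs ξ p‖ ^ 2 : ℝ) : EReal) ∧
          P.VN0 (P.closedLoop u0 ξ p).1 (P.closedLoop u0 ξ p).2 ≤
            P.VN0 ξ.1 ξ.2 - ((a₃ * ‖OffsetFree.targetError zs ξ p‖ ^ 2 : ℝ) : EReal)
              + ((σ ‖p‖ : ℝ) : EReal)) ∧
      -- (c) robust exponential target-tracking stability
      OffsetFree.IsRES (P.closedLoop u0) (P.closedLoopPert u0 Bc δ₀ δ) (P.domain Bc δ₀ ρ)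
        (OffsetFree.targetError zs) (OffsetFree.targetError zs) ∧
      -- (d) robust asymptotic setpoint-tracking stability
      OffsetFree.IsRAS (P.closedLoop u0) (P.closedLoopPert u0 Bc δ₀ δ) (P.domain Bc δ₀ ρ)
        (P.refError u0) (OffsetFree.targetError zs) ∧
      -- (e) exponential version for Lipschitz maps
      (OffsetFree.LipschitzOnBounded P.g (P.U ×ˢ P.Y) →
        OffsetFree.LipschitzOnBounded P.h (P.X ×ˢ P.U ×ˢ P.D) →
        OffsetFree.IsRES (P.closedLoop u0) (P.closedLoopPert u0 Bc δ₀ δ) (P.domain Bc δ₀ ρ)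
          (P.refError u0) (OffsetFree.targetError zs)) := by
  have H : P.Standing zs u0 Q R Pf w Bc δ₀ := ⟨hzs, hu0, hcont, hcons, hterm, hquad, hsstp, hPf⟩
  obtain ⟨δ, a₁, a₂, σ, hδ, hδ1, ha₁, ha₁₂, hσ, hbd, hdec⟩ := H.exists_robust_descent hρ
  have ha₂ : 0 < a₂ := ha₁.trans ha₁₂
  have hinv : ∀ ξ ∈ P.domain Bc δ₀ ρ, ∀ p ∈ P.closedLoopPert u0 Bc δ₀ δ ξ,
      P.closedLoop u0 ξ p ∈ P.domain Bc δ₀ ρ := fun ξ hξ p hp => (hdec ξ hξ p hp).1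
  have hnn : ∀ ξ, ∀ p ∈ P.closedLoopPert u0 Bc δ₀ δ ξ, 0 ≤ ‖p‖ := fun _ p _ => p.norm_nonneg
  have hlow : ∀ ξ ∈ P.domain Bc δ₀ ρ,
      a₁ * ‖ξ.1 - (zs ξ.2).1‖ ^ 2 ≤ P.VN ξ.1 (u0 ξ.1 ξ.2) ξ.2 := fun ξ hξ =>
    (le_add_of_nonneg_right (by positivity)).trans (hbd ξ hξ).1
  obtain ⟨c, lam, γ, hc, hlam, hγ, hbound⟩ := OffsetFree.exists_exponential_bound hinv hnn
    (V := fun ξ => P.VN ξ.1 (u0 ξ.1 ξ.2) ξ.2) (e := fun ξ => ξ.1 - (zs ξ.2).1)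
    ha₁ ha₂ ha₁ ha₁₂ hσ.1 hlow (fun ξ hξ => (hbd ξ hξ).2) fun ξ hξ p hp => (hdec ξ hξ p hp).2
  -- The input part of the lower bound against the quadratic upper bound: a₁|u - u_s|² ≤ V ≤
  -- a₂|δx̂|².
  have hκ : ∀ ξ ∈ P.domain Bc δ₀ ρ,
      ‖P.kappa u0 ξ.1 ξ.2 - (zs ξ.2).2‖ ≤ √(a₂ / a₁) * ‖ξ.1 - (zs ξ.2).1‖ := by
    intro ξ hξ
    refine (pow_le_pow_iff_left₀ (norm_nonneg _) (by positivity) two_ne_zero).1 ?_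
    rw [mul_pow, Real.sq_sqrt (by positivity), div_mul_eq_mul_div, le_div_iff₀ ha₁, mul_comm]
    exact (le_add_of_nonneg_left (by positivity)).trans ((hbd ξ hξ).1.trans (hbd ξ hξ).2)
  have hκ0 : 0 < √(a₂ / a₁) := by positivity
  -- The compact sets are fixed before the moduli, so that (d) and (e) can use different moduli on
  -- them.
  obtain ⟨A, hA, E, hE, hAc, hEc, href⟩ := H.exists_refError_bound hκ0 hκ
  have hpert : ∀ ξ, P.closedLoopPert u0 Bc δ₀ δ ξ ⊆ P.closedLoopPert u0 Bc δ₀ 1 ξ :=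
    fun ξ p hp => ⟨hp.1, hp.2.1, hp.2.2.trans hδ1⟩
  refine ⟨δ, hδ, ⟨H.isClosed_domain, hinv⟩, ⟨a₁, a₂, a₁, σ, ha₁, ha₂, ha₁, hσ, fun ξ hξ p hp => ?_⟩,
    ⟨c, lam, γ, hc, hlam, hγ, hbound⟩, ?_, fun hgL hhL => ?_⟩
  · rw [OffsetFree.MPC.VN0_eq hu0 hξ.1, OffsetFree.MPC.VN0_eq hu0 (hinv ξ hξ p hp).1]
    exact ⟨EReal.coe_le_coe_iff.2 (hlow ξ hξ), EReal.coe_le_coe_iff.2 (hbd ξ hξ).2,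
      mod_cast (hdec ξ hξ p hp).2⟩
  · obtain ⟨σh, hσh, hh⟩ := OffsetFree.exists_modulus hAc (hcont.h_cont.mono hA)
    obtain ⟨σg, hσg, hg⟩ := OffsetFree.exists_modulus hEc (hcont.g_cont.mono hE)
    have hC : 0 < √(a₂ / a₁) + 1 := by positivity
    exact OffsetFree.IsRAS.of_exponential_bound hinv hnn hc hlam hγ hbound
      (hσg.1.comp ((OffsetFree.IsClassK.linear hC).add
        (hσh.1.comp (OffsetFree.IsClassK.linear hC))))
      fun ξ hξ p hp => href σh σg hσh.1 hσg.1 hh hg ξ hξ p (hpert ξ hp)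
  · obtain ⟨Kh, hKh⟩ := hhL A hA hAc.isBounded
    obtain ⟨Kg, hKg⟩ := hgL E hE hEc.isBounded
    -- Lipschitz constants may be zero, while class 𝒦 needs a positive slope.
    have hh0 : 0 < (Kh : ℝ) + 1 := by positivity
    have hg0 : 0 < (Kg : ℝ) + 1 := by positivity
    refine OffsetFree.IsRES.of_exponential_bound hinv hnn hc hlam hγ hbound
      (L := (Kg + 1) * ((√(a₂ / a₁) + 1) + (Kh + 1) * (√(a₂ / a₁) + 1))) (by positivity)
      fun ξ hξ p hp => (href _ _ (.linear hh0) (.linear hg0) (fun a ha b hb => ?_)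
        (fun a ha b hb => ?_) ξ hξ p (hpert ξ hp)).trans_eq ?_
    · exact (hKh.dist_le_mul a ha b hb).trans (by gcongr; linarith)
    · exact (hKg.dist_le_mul a ha b hb).trans (by gcongr; linarith)
    · change _ = ((Kg : ℝ) + 1) * ((√(a₂ / a₁) + 1) + (Kh + 1) * (√(a₂ / a₁) + 1)) *
        (‖OffsetFree.targetError zs ξ p‖ + ‖p‖)
      ring
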